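/- \textbf{Setting.} Let $\mathbb X$ be a finite alphabet, $\rho>0$ and $0<R<\ln|\mathbb X|$. For a finite set $A$ let $\mathcal M(A)$ be the set of probability mass functions (PMFs) on $A$; $H(Q)=-\sum_a Q(a)\ln Q(a)$ is entropy, and $D(Q\|P)=\sum_a Q(a)\ln\frac{Q(a)}{P(a)}$ if $Q\ll P$, $D(Q\|P)=+\infty$ otherwise. A source is an arbitrary sequence $\mathbf Y=(P_{Y^n})_{n\ge1}$ with $P_{Y^n}\in\mathcal M(\mathbb X^n)$. All exponents are extended reals, $\inf\emptyset=+\infty$, $\sup\emptyset=-\infty$. \emph{Compression exponents.} For a source $\mathbf X$, $$E_n^s(R,\rho)=\min_{L_n}\frac1n\ln\mathbb E\big[\exp\{\rho\min\{L_n(X^n)\ln2,\,nR\}\}\big],$$ over all $L_n:\mathbb X^n\to\mathbb N$ with $\sum_{x^n}2^{-L_n(x^n)}\le1$; $E_u^s(R,\rho)=\limsup_nE_n^s(R,\rho)$ and $E_l^s(R,\rho)=\liminf_nE_n^s(R,\rho)$. \emph{Guessing exponents.} Let $k=\lceil nR/\ln2\rceil$, and let $U^k$ be uniform on $\{0,1\}^k$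 and independent of $X^n$. An encryption function $f_n$ maps a message $x^n$ and a key $u$ to a finite binary string (of variable length) and is injective in $x^n$ for each fixed $u$; the cryptogram is $Y=f_n(X^n,U^k)$. Given $Y=y$, an attacker guesses the messages one by one in decreasing order of the posterior probabilities $P_{X^n|Y}(\cdot\mid y)$ (ties broken arbitrarily), and $G_{f_n}(x^n\mid y)\in\{1,\dots,|\mathbb X|^n\}$ is the position of $x^n$ in this order. Put $E_n^g(R,\rho)=\sup_{f_n}\frac1n\ln\mathbb E[G_{f_n}(X^n\mid Y)^\rho]$, $E_u^g(R,\rho)=\limsup_nE_n^g(R,\rho)$ and $E_l^g(R,\rho)=\liminf_nE_n^g(R,\rho)$. \emph{General bounds.} For sources $\mathbf Y,\mathbf X$ and $\theta\ge0$ let $E_u(\mathbf Y,\mathbf X,\theta)$ and $E_l(\mathbf Y,\mathbf X,\theta)$ be the limsup and the liminf of $\frac1n\{\theta H(P_{Y^n})-D(P_{Y^n}\|P_{X^n})\}$, and let $D_u(\mathbf Y\|\mathbf X)=\limsup_n\frac1nD(P_{Y^n}\|P_{X^n})$. Let $$\overline H(\mathbf Y)=\inf\Big\{t:\lim_n\Pr\big\{\tfrac1n\ln\tfrac1{P_{Y^n}(Y^n)}>t\big\}=0\Big\},\qquad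 \underline H(\mathbf Y)=\sup\Big\{t:\lim_n\Pr\big\{\tfrac1n\ln\tfrac1{P_{Y^n}(Y^n)}<t\big\}=0\Big\}.$$ The general lower bound (on $E_l^s(R,\rho)$) and the general upper bound (on $E_u^s(R,\rho)$) are $$\mathcal L=\max\Big\{\rho R-\inf_{\mathbf Y:\underline H(\mathbf Y)>R}D_u(\mathbf Y\|\mathbf X),\ \sup_{\mathbf Y:\overline H(\mathbf Y)\le R}E_l(\mathbf Y,\mathbf X,\rho)\Big\},\qquad \mathcal U=\min_{0\le\theta\le\rho}\Big\{(\rho-\theta)R+\max_{\mathbf Y}E_u(\mathbf Y,\mathbf X,\theta)\Big\}.$$ \textbf{Claim.} Let $\mathbf X$ be the iid source with marginal $P_1\in\mathcal M(\mathbb X)$, that is, $P_{X^n}(x^n)=\prod_{i=1}^nP_1(x_i)$. Below, $P_Y$ ranges over $\mathcal M(\mathbb X)$. Then $$\inf_{\mathbf Y:\underline H(\mathbf Y)>R}D_u(\mathbf Y\|\mathbf X)=\inf_{P_Y:H(P_Y)>R}D(P_Y\|P_1),$$ $$\sup_{\mathbf Y:\overline H(\mathbf Y)\le R}E_l(\mathbf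 Y,\mathbf X,\rho)\ \ge\sup_{P_Y:H(P_Y)\le R}\{\rho H(P_Y)-D(P_Y\|P_1)\},$$ $$\max_{\mathbf Y}E_u(\mathbf Y,\mathbf X,\theta)=\sup_{P_Y}\{\theta H(P_Y)-D(P_Y\|P_1)\}\qquad(0\le\theta\le\rho),$$ where the maximum over $\mathbf Y$ is attained. The two general bounds coincide (the minimum over $\theta$ in $\mathcal U$ being attained), and $$\mathcal L=E_l^s(R,\rho)=E_u^s(R,\rho)=\mathcal U=\sup_{P_Y}\big\{\rho\min\{H(P_Y),R\}-D(P_Y\|P_1)\big\}.$$ The supremum is attained, and it is also the optimal guessing exponent (the Merhav--Arikan formula): $$E_l^g(R,\rho)=E_u^g(R,\rho)=\max_{P_Y}\big\{\rho\min\{H(P_Y),R\}-D(P_Y\|P_1)\big\}.$$ -/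

import Mathlib

open Filter Topology

noncomputable section

namespace GuessingCipher

/-! Probability mass functions on a finite type `ι` are the points of `stdSimplex ℝ ι`.
All exponents are extended reals, with `inf ∅ = +∞` and `sup ∅ = -∞`. -/

/-- Shannon entropy in nats. -/
def entropy {ι : Type*} [Fintype ι] (p : stdSimplex ℝ ι) : ℝ :=
  ∑ x, Real.negMulLog (p.1 x)

open Classical in
/-- Relative entropy `D(q ‖ p)` in nats, equal to `+∞` unless `q ≪ p`. -/
def relEntropy {ι : Type*} [Fintype ι] (q p : stdSimplex ℝ ι) : EReal :=
  if ∀ x, p.1 x = 0 → q.1 x = 0 then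
    ((∑ x, q.1 x * Real.log (q.1 x / p.1 x) : ℝ) : EReal)
  else ⊤

/-- The probability of the event `A` under `p`. -/
def prob {ι : Type*} [Fintype ι] (p : stdSimplex ℝ ι) (A : Set ι) : ℝ :=
  ∑ x, A.indicator p.1 x

/-- A source over the alphabet `X`: an arbitrary sequence of probability mass functions, the
`n`-th one on `X ^ n`; no consistency between different `n` is required. -/
abbrev Source (X : Type*) [Fintype X] : Type _ :=
  ∀ n : ℕ, stdSimplex ℝ (Fin n → X)

/-- The iid source with marginal `P`. -/
def iidSource {X : Type*} [Fintype X] (P : stdSimplex ℝ X) : Source X := fun n =>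
  ⟨fun x => ∏ i, P.1 (x i),
    fun x => Finset.prod_nonneg fun i _ => P.2.1 (x i), by
      classical
      rw [← Fintype.piFinset_univ, Finset.sum_prod_piFinset]
      simp [P.2.2]⟩

/-! ### The compression problem with saturated exponential cost -/

/-- Length functions on `X ^ n`: those satisfying Kraft's inequality. -/
def IsLengthFunction {ι : Type*} [Fintype ι] (L : ι → ℕ) : Prop :=
  ∑ x, ((2 : ℝ) ^ L x)⁻¹ ≤ 1

/-- `E[exp(ρ min(L(X^n) ln 2, n R))]`. -/
def compressionCost {X : Type*} [Fintype X] {n : ℕ} (p : stdSimplex ℝ (Fin n → X)) (R ρ : ℝ)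
    (L : (Fin n → X) → ℕ) : ℝ :=
  ∑ x, p.1 x * Real.exp (ρ * min (L x * Real.log 2) (n * R))

/-- `E_n^s(R, ρ)`. -/
def compressionExponentAt {X : Type*} [Fintype X] (S : Source X) (R ρ : ℝ) (n : ℕ) : EReal :=
  ⨅ (L : (Fin n → X) → ℕ) (_ : IsLengthFunction L),
    (((n : ℝ)⁻¹ * Real.log (compressionCost (S n) R ρ L) : ℝ) : EReal)

/-- `E_u^s(R, ρ)`. -/
def upperCompressionExponent {X : Type*} [Fintype X] (S : Source X) (R ρ : ℝ) : EReal :=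
  limsup (compressionExponentAt S R ρ) atTop

/-- `E_l^s(R, ρ)`. -/
def lowerCompressionExponent {X : Type*} [Fintype X] (S : Source X) (R ρ : ℝ) : EReal :=
  liminf (compressionExponentAt S R ρ) atTop

/-! ### Guessing in the Shannon cipher system -/

/-- The number of key bits for block length `n` at key rate `R` nats per letter. -/
def keyBits (n : ℕ) (R : ℝ) : ℕ := ⌈n * R / Real.log 2⌉₊

/-- Encryption of messages in `X ^ n` with a key of `k` bits; the cryptogram is a binary string of
variable length, and encryption is invertible for each fixed key. -/
structure Encryption (X : Type*) (n k : ℕ) where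
  enc : (Fin n → X) → (Fin k → Bool) → List Bool
  injective : ∀ u, Function.Injective fun x => enc x u

/-- The probability that the message is `x` and the cryptogram is `y`, the key being uniform and
independent of the message. -/
def Encryption.joint {X : Type*} [Fintype X] {n k : ℕ} (f : Encryption X n k)
    (p : stdSimplex ℝ (Fin n → X)) (x : Fin n → X) (y : List Bool) : ℝ :=
  ∑ u : Fin k → Bool, if f.enc x u = y then p.1 x * ((2 : ℝ) ^ k)⁻¹ else 0

/-- The posterior probability of the message `x` given the cryptogram `y`
(and `0` if `y` has probability zero). -/
def Encryption.posterior {X : Type*} [Fintype X] {n k : ℕ} (f : Encryption X n k)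
    (p : stdSimplex ℝ (Fin n → X)) (x : Fin n → X) (y : List Bool) : ℝ :=
  f.joint p x y / ∑ x', f.joint p x' y

/-- A guessing strategy orders, for each cryptogram, all the messages; `x` is guess number
`G y x + 1` when the cryptogram is `y`. -/
abbrev GuessingStrategy (X : Type*) [Fintype X] (n : ℕ) : Type _ :=
  List Bool → ((Fin n → X) ≃ Fin (Fintype.card X ^ n))

/-- `G` guesses in decreasing order of the posterior probabilities (ties broken arbitrarily). -/
def IsOptimalGuessing {X : Type*} [Fintype X] {n k : ℕ} (p : stdSimplex ℝ (Fin n → X))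
    (f : Encryption X n k) (G : GuessingStrategy X n) : Prop :=
  ∀ y x x', f.posterior p x' y < f.posterior p x y → G y x < G y x'

/-- `E[G(X^n | Y)^ρ]` for `Y = f(X^n, U^k)`. -/
def guessingMoment {X : Type*} [Fintype X] {n k : ℕ} (p : stdSimplex ℝ (Fin n → X))
    (f : Encryption X n k) (G : GuessingStrategy X n) (ρ : ℝ) : ℝ :=
  ∑ x, ∑ u : Fin k → Bool,
    p.1 x * ((2 : ℝ) ^ k)⁻¹ * (((G (f.enc x u) x : ℕ) : ℝ) + 1) ^ ρ

/-- `E_n^g(R, ρ)`. The moment is the same for all optimal strategies of a given encryption. -/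
def guessingExponentAt {X : Type*} [Fintype X] (S : Source X) (R ρ : ℝ) (n : ℕ) : EReal :=
  ⨆ (f : Encryption X n (keyBits n R)) (G : GuessingStrategy X n)
    (_ : IsOptimalGuessing (S n) f G),
    (((n : ℝ)⁻¹ * Real.log (guessingMoment (S n) f G ρ) : ℝ) : EReal)

/-- `E_u^g(R, ρ)`. -/
def upperGuessingExponent {X : Type*} [Fintype X] (S : Source X) (R ρ : ℝ) : EReal :=
  limsup (guessingExponentAt S R ρ) atTop

/-- `E_l^g(R, ρ)`. -/
def lowerGuessingExponent {X : Type*} [Fintype X] (S : Source X) (R ρ : ℝ) : EReal :=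
  liminf (guessingExponentAt S R ρ) atTop

/-! ### Information-spectrum quantities and the general bounds -/

/-- `(1/n) (θ H(P_{Y^n}) - D(P_{Y^n} ‖ P_{X^n}))`. -/
def tiltedRate {X : Type*} [Fintype X] (Y S : Source X) (θ : ℝ) (n : ℕ) : EReal :=
  (((n : ℝ)⁻¹ : ℝ) : EReal) *
    (((θ * entropy (Y n) : ℝ) : EReal) - relEntropy (Y n) (S n))

/-- `E_u(Y, X, θ)`. -/
def upperTiltedRate {X : Type*} [Fintype X] (Y S : Source X) (θ : ℝ) : EReal :=
  limsup (tiltedRate Y S θ) atTop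

/-- `E_l(Y, X, θ)`. -/
def lowerTiltedRate {X : Type*} [Fintype X] (Y S : Source X) (θ : ℝ) : EReal :=
  liminf (tiltedRate Y S θ) atTop

/-- The upper divergence `D_u(Y ‖ X)`. -/
def upperDivergence {X : Type*} [Fintype X] (Y S : Source X) : EReal :=
  limsup (fun n : ℕ => (((n : ℝ)⁻¹ : ℝ) : EReal) * relEntropy (Y n) (S n)) atTop

/-- The normalized self-information `(1/n) ln (1 / P_{Y^n}(x))`. -/
def selfInfoRate {X : Type*} [Fintype X] (Y : Source X) (n : ℕ) (x : Fin n → X) : ℝ :=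
  (n : ℝ)⁻¹ * Real.log (1 / (Y n).1 x)

/-- The spectral sup-entropy-rate. -/
def spectralSupEntropyRate {X : Type*} [Fintype X] (Y : Source X) : EReal :=
  ⨅ (t : ℝ) (_ : Tendsto (fun n => prob (Y n) {x | t < selfInfoRate Y n x}) atTop (𝓝 0)),
    (t : EReal)

/-- The spectral inf-entropy-rate. -/
def spectralInfEntropyRate {X : Type*} [Fintype X] (Y : Source X) : EReal :=
  ⨆ (t : ℝ) (_ : Tendsto (fun n => prob (Y n) {x | selfInfoRate Y n x < t}) atTop (𝓝 0)),
    (t : EReal)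

/-- The infimum of `D_u(Y ‖ X)` over the sources `Y` with spectral inf-entropy-rate above `R`. -/
def errorExponentBound {X : Type*} [Fintype X] (S : Source X) (R : ℝ) : EReal :=
  ⨅ (Y : Source X) (_ : (R : EReal) < spectralInfEntropyRate Y), upperDivergence Y S

/-- The supremum of `E_l(Y, X, ρ)` over the sources `Y` with spectral sup-entropy-rate at most
`R`. -/
def correctDecodingBound {X : Type*} [Fintype X] (S : Source X) (R ρ : ℝ) : EReal :=
  ⨆ (Y : Source X) (_ : spectralSupEntropyRate Y ≤ (R : EReal)), lowerTiltedRate Y S ρ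

/-- The general lower bound on `E_l^s(R, ρ)`. -/
def generalLowerBound {X : Type*} [Fintype X] (S : Source X) (R ρ : ℝ) : EReal :=
  max (((ρ * R : ℝ) : EReal) - errorExponentBound S R) (correctDecodingBound S R ρ)

/-- The function of `θ` that is minimized in the general upper bound. -/
def upperBoundAt {X : Type*} [Fintype X] (S : Source X) (R ρ θ : ℝ) : EReal :=
  (((ρ - θ) * R : ℝ) : EReal) + ⨆ Y : Source X, upperTiltedRate Y S θ

/-- The general upper bound on `E_u^s(R, ρ)`. -/
def generalUpperBound {X : Type*} [Fintype X] (S : Source X) (R ρ : ℝ) : EReal :=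
  ⨅ θ ∈ Set.Icc (0 : ℝ) ρ, upperBoundAt S R ρ θ

/-! ### Single-letter quantities -/

/-- `ρ min(H(Q), R) - D(Q ‖ P)`. -/
def singleLetterValue {X : Type*} [Fintype X] (P : stdSimplex ℝ X) (R ρ : ℝ)
    (Q : stdSimplex ℝ X) : EReal :=
  ((ρ * min (entropy Q) R : ℝ) : EReal) - relEntropy Q P

/-- `sup_Q (ρ min(H(Q), R) - D(Q ‖ P))`. -/
def singleLetterExponent {X : Type*} [Fintype X] (P : stdSimplex ℝ X) (R ρ : ℝ) : EReal :=
  ⨆ Q : stdSimplex ℝ X, singleLetterValue P R ρ Q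

end GuessingCipher

end

noncomputable section

namespace GuessingCipher

variable {ι X : Type*} [Fintype ι] [Fintype X]

/-! ### Entropy, relative entropy and exponential tilting -/

/-! Everything is squeezed at one saddle point. Since `D(Q‖P) = -H(Q) - ∑ Q ln P`, Gibbs' inequality
against the law proportional to `P ^ (1/(1+θ))` gives `θ H(Q) - D(Q‖P) ≤ (1+θ) ln ∑ P ^ (1/(1+θ))`,
with equality at that tilted law (`tilt_bound`, `tilt_eq`). As `ρ min(H,R) ≤ θ H + (ρ-θ) R` for `0 ≤
θ ≤ ρ`, each such `θ` bounds the single-letter exponent from above. The entropy of the tilted law is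
continuous in `θ`, so either it takes the value `R` or an endpoint serves, and for that `θ` the
bound is an equality (`exists_saddle`). It remains to bound each exponent below by the value at the
tilted law and above by the value at `θ`.

General bounds: an arbitrary law on `X ^ n` is replaced by the average of its marginals. Its mean
log-likelihood under a product law depends on that average alone, and its entropy is at most `n`
times that of the average, so nothing is lost by passing to one letter. Conversely, a Chernoff bound
identifies the spectral rates needed for iid sources.

Upper bounds on costs: a code for the tilted law handles compression. For guessing, the guess number
is at most `2 ^ k` and at most a ratio of power sums of posteriors; interpolating the two and
applying Jensen's inequality removes the cryptogram (`guessingMoment_le`).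

Lower bounds on costs: by change of measure (`eventually_le_rate_of_moment`) it suffices that a
small cost is rare under `Q ^ n`. For codes this is Kraft's inequality. For guessing, the messages
are sorted by `Q ^ n` and cut into blocks of size `2 ^ k`, with only the index inside a block
encrypted. A list of `T` guesses catches at most `T` words of each block, and a word in a later
block weighs no more than the average of the block before it, so the caught probability is small
(`sum_le_of_card_block_le`). -/

/-- `∑ q ln p`. -/
def meanLog (q p : stdSimplex ℝ ι) : ℝ := ∑ x, q.1 x * Real.log (p.1 x)

/-- Absolute continuity `q ≪ p`. -/
def AbsCont (q p : stdSimplex ℝ ι) : Prop := ∀ x, p.1 x = 0 → q.1 x = 0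

/-- Splitting off `meanLog`, which is linear in `q`, leaves entropy as the only nonlinear term; all
later estimates use this form. -/
theorem relEntropy_of_absCont {q p : stdSimplex ℝ ι} (h : AbsCont q p) :
    relEntropy q p = ((-entropy q - meanLog q p : ℝ) : EReal) := by
  have h' : ∀ x, p.1 x = 0 → q.1 x = 0 := h
  rw [relEntropy, if_pos h', EReal.coe_eq_coe_iff, entropy, meanLog, ← Finset.sum_neg_distrib,
    ← Finset.sum_sub_distrib]
  refine Finset.sum_congr rfl fun x _ => ?_
  by_cases hq : q.1 x = 0
  · simp [hq]
  · rw [Real.log_div hq fun hp => hq (h x hp), Real.negMulLog]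
    ring

theorem relEntropy_of_not_absCont {q p : stdSimplex ℝ ι} (h : ¬ AbsCont q p) :
    relEntropy q p = ⊤ := by
  have h' : ¬ ∀ x, p.1 x = 0 → q.1 x = 0 := h
  rw [relEntropy, if_neg h']

theorem coe_sub_relEntropy_of_not_absCont {q p : stdSimplex ℝ ι} (h : ¬ AbsCont q p) (a : ℝ) :
    (a : EReal) - relEntropy q p = ⊥ := by
  rw [relEntropy_of_not_absCont h, EReal.sub_top]

theorem meanLog_self (q : stdSimplex ℝ ι) : meanLog q q = -entropy q := by
  simp [meanLog, entropy, Real.negMulLog, Finset.sum_neg_distrib]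

/-- Gibbs' inequality. -/
theorem entropy_le_neg_meanLog {q p : stdSimplex ℝ ι} (h : AbsCont q p) :
    entropy q ≤ -meanLog q p := by
  have key : ∀ x, Real.negMulLog (q.1 x) + q.1 x * Real.log (p.1 x) ≤ p.1 x - q.1 x := by
    intro x
    rcases (q.2.1 x).eq_or_lt' with hq | hq
    · simpa [hq] using p.2.1 x
    · have hp : 0 < p.1 x := (p.2.1 x).lt_of_ne' fun hp => hq.ne' (h x hp)
      have h1 := Real.log_le_sub_one_of_pos (div_pos hp hq)
      rw [Real.log_div hp.ne' hq.ne'] at h1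
      have h2 := mul_le_mul_of_nonneg_left h1 hq.le
      have h3 : q.1 x * (p.1 x / q.1 x - 1) = p.1 x - q.1 x := by field_simp
      rw [Real.negMulLog]
      linarith
  have h1 := Finset.sum_le_sum fun x (_ : x ∈ Finset.univ) => key x
  rw [Finset.sum_add_distrib, Finset.sum_sub_distrib, p.2.2, q.2.2] at h1
  rw [entropy, meanLog]
  linarith

theorem exists_pos (p : stdSimplex ℝ ι) : ∃ x, 0 < p.1 x := by
  by_contra! h
  have := Finset.sum_nonpos fun x (_ : x ∈ Finset.univ) => h x
  rw [p.2.2] at this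
  linarith

/-- The normalization of `P ^ (1 / (1 + θ))`. -/
def tiltSum (P : stdSimplex ℝ ι) (θ : ℝ) : ℝ := ∑ x, P.1 x ^ (1 + θ)⁻¹

theorem tiltSum_pos (P : stdSimplex ℝ ι) (θ : ℝ) : 0 < tiltSum P θ := by
  obtain ⟨x, hx⟩ := exists_pos P
  exact Finset.sum_pos' (fun y _ => Real.rpow_nonneg (P.2.1 y) _)
    ⟨x, Finset.mem_univ x, Real.rpow_pos_of_pos hx _⟩

/-- The distribution proportional to `P ^ (1 / (1 + θ))`. -/
def tilted (P : stdSimplex ℝ ι) (θ : ℝ) : stdSimplex ℝ ι :=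
  ⟨fun x => P.1 x ^ (1 + θ)⁻¹ / tiltSum P θ,
    fun x => div_nonneg (Real.rpow_nonneg (P.2.1 x) _) (tiltSum_pos P θ).le, by
      rw [← Finset.sum_div]
      exact div_self (tiltSum_pos P θ).ne'⟩

theorem tilted_apply (P : stdSimplex ℝ ι) (θ : ℝ) (x : ι) :
    (tilted P θ).1 x = P.1 x ^ (1 + θ)⁻¹ / tiltSum P θ := rfl

theorem absCont_tilted {P : stdSimplex ℝ ι} {θ : ℝ} (hθ : 0 ≤ θ) : AbsCont (tilted P θ) P := by
  intro x hx
  rw [tilted_apply, hx, Real.zero_rpow (by positivity), zero_div]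

theorem tilted_pos {P : stdSimplex ℝ ι} {θ : ℝ} {x : ι} (hx : 0 < P.1 x) :
    0 < (tilted P θ).1 x :=
  div_pos (Real.rpow_pos_of_pos hx _) (tiltSum_pos P θ)

theorem meanLog_tilted {P Q : stdSimplex ℝ ι} {θ : ℝ} (h : AbsCont Q P) :
    meanLog Q (tilted P θ) = (1 + θ)⁻¹ * meanLog Q P - Real.log (tiltSum P θ) := by
  have key : ∀ x, Q.1 x * Real.log ((tilted P θ).1 x)
      = (1 + θ)⁻¹ * (Q.1 x * Real.log (P.1 x)) - Q.1 x * Real.log (tiltSum P θ) := by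
    intro x
    by_cases hq : Q.1 x = 0
    · simp [hq]
    · have hp : 0 < P.1 x := (P.2.1 x).lt_of_ne' fun hp => hq (h x hp)
      rw [tilted_apply, Real.log_div (Real.rpow_pos_of_pos hp _).ne' (tiltSum_pos P θ).ne',
        Real.log_rpow hp]
      ring
  rw [meanLog, Finset.sum_congr rfl fun x _ => key x, Finset.sum_sub_distrib, ← Finset.mul_sum,
    ← Finset.sum_mul, Q.2.2, one_mul, meanLog]

/-- Gibbs' inequality for `Q` against `tilted P θ`, multiplied by `1 + θ`. -/
theorem tilt_bound {P Q : stdSimplex ℝ ι} {θ : ℝ} (hθ : 0 ≤ θ) (h : AbsCont Q P) :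
    (1 + θ) * entropy Q + meanLog Q P ≤ (1 + θ) * Real.log (tiltSum P θ) := by
  have hac : AbsCont Q (tilted P θ) := by
    intro x hx
    by_contra hq
    exact (tilted_pos (θ := θ) ((P.2.1 x).lt_of_ne' fun hp => hq (h x hp))).ne' hx
  have h1 := entropy_le_neg_meanLog hac
  rw [meanLog_tilted h] at h1
  have hp : 0 < 1 + θ := by linarith
  have h2 := mul_le_mul_of_nonneg_left h1 hp.le
  have h3 : (1 + θ) * -((1 + θ)⁻¹ * meanLog Q P - Real.log (tiltSum P θ))
      = -meanLog Q P + (1 + θ) * Real.log (tiltSum P θ) := by field_simp; ring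
  linarith

theorem tilt_eq (P : stdSimplex ℝ ι) {θ : ℝ} (hθ : 0 ≤ θ) :
    (1 + θ) * entropy (tilted P θ) + meanLog (tilted P θ) P
      = (1 + θ) * Real.log (tiltSum P θ) := by
  have h1 := meanLog_tilted (θ := θ) (absCont_tilted (P := P) hθ)
  rw [meanLog_self] at h1
  have hp : 0 < 1 + θ := by linarith
  have h3 : (1 + θ) * ((1 + θ)⁻¹ * meanLog (tilted P θ) P - Real.log (tiltSum P θ))
      = meanLog (tilted P θ) P - (1 + θ) * Real.log (tiltSum P θ) := by field_simp
  rw [← h1] at h3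
  linarith

theorem continuousOn_entropy_tilted (P : stdSimplex ℝ ι) (ρ : ℝ) :
    ContinuousOn (fun θ => entropy (tilted P θ)) (Set.Icc 0 ρ) := by
  have hr : ∀ x, ContinuousOn (fun θ : ℝ => P.1 x ^ (1 + θ)⁻¹) (Set.Icc 0 ρ) := by
    intro x
    refine ContinuousOn.rpow continuousOn_const ?_ fun θ hθ => Or.inr ?_
    · exact ContinuousOn.inv₀ (by fun_prop) fun θ hθ => by linarith [hθ.1]
    · have := hθ.1
      positivity
  refine continuousOn_finsetSum _ fun x _ => Real.continuous_negMulLog.comp_continuousOn ?_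
  exact (hr x).div (continuousOn_finsetSum _ fun y _ => hr y) fun θ _ => (tiltSum_pos P θ).ne'

/-- A saddle point of `(ρ - θ) R + θ H(Q) - D(Q ‖ P)`. -/
theorem exists_saddle (P : stdSimplex ℝ ι) (R : ℝ) {ρ : ℝ} (hρ : 0 ≤ ρ) :
    ∃ θ ∈ Set.Icc 0 ρ, ρ * min (entropy (tilted P θ)) R + entropy (tilted P θ)
        + meanLog (tilted P θ) P
      = (ρ - θ) * R + (1 + θ) * Real.log (tiltSum P θ) := by
  -- Complementary slackness: `θ = 0` needs `min(H,R) = R`, `θ = ρ` needs `min(H,R) = H`, and an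
  -- interior `θ` needs `H = R`.
  by_cases h0 : R ≤ entropy (tilted P 0)
  · refine ⟨0, ⟨le_rfl, hρ⟩, ?_⟩
    rw [← tilt_eq P le_rfl, min_eq_right h0]
    ring
  by_cases h1 : entropy (tilted P ρ) ≤ R
  · refine ⟨ρ, ⟨hρ, le_rfl⟩, ?_⟩
    rw [← tilt_eq P hρ, min_eq_left h1]
    ring
  · push Not at h0 h1
    obtain ⟨θ, hθ, h⟩ := intermediate_value_Icc hρ (continuousOn_entropy_tilted P ρ)
      ⟨h0.le, h1.le⟩
    refine ⟨θ, hθ, ?_⟩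
    rw [← tilt_eq P hθ.1, min_eq_right (le_of_eq h.symm)]
    have h' : entropy (tilted P θ) = R := h
    rw [h']
    ring

/-! ### Product distributions and averaged marginals -/

theorem iidSource_apply (Q : stdSimplex ℝ X) (n : ℕ) (x : Fin n → X) :
    (iidSource Q n).1 x = ∏ i, Q.1 (x i) := rfl

theorem sum_prod_fin (n : ℕ) (g : Fin n → X → ℝ) :
    ∑ x : Fin n → X, ∏ i, g i (x i) = ∏ i, ∑ a, g i a := by
  classical
  rw [← Fintype.piFinset_univ, Finset.sum_prod_piFinset]

theorem iidSource_marginal (Q : stdSimplex ℝ X) {n : ℕ} (i : Fin n) (f : X → ℝ) :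
    ∑ x, (iidSource Q n).1 x * f (x i) = ∑ a, Q.1 a * f a := by
  have h : ∀ x : Fin n → X, (iidSource Q n).1 x * f (x i)
      = ∏ j, Q.1 (x j) * (if j = i then f (x j) else 1) := by
    intro x
    rw [iidSource_apply, Finset.prod_mul_distrib]
    simp
  rw [Finset.sum_congr rfl fun x _ => h x,
    sum_prod_fin n fun j a => Q.1 a * (if j = i then f a else 1),
    Finset.prod_eq_single i]
  · simp
  · intro j _ hj
    simp [hj, Q.2.2]
  · simp

theorem log_iidSource {Q : stdSimplex ℝ X} {n : ℕ} {x : Fin n → X}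
    (h : (iidSource Q n).1 x ≠ 0) :
    Real.log ((iidSource Q n).1 x) = ∑ i, Real.log (Q.1 (x i)) := by
  rw [iidSource_apply] at h ⊢
  exact Real.log_prod fun i _ => Finset.prod_ne_zero_iff.1 h i (Finset.mem_univ i)

open Classical in
/-- The average of the one-letter marginals. -/
def avgMarginal {n : ℕ} (hn : 0 < n) (p : stdSimplex ℝ (Fin n → X)) : stdSimplex ℝ X :=
  ⟨fun a => (n : ℝ)⁻¹ * ∑ i, ∑ x, if x i = a then p.1 x else 0, fun a =>
    mul_nonneg (by positivity) (Finset.sum_nonneg fun i _ => Finset.sum_nonneg fun x _ => by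
      split_ifs
      · exact p.2.1 x
      · exact le_rfl), by
    rw [← Finset.mul_sum, Finset.sum_comm]
    have : ∀ i : Fin n, ∑ a, ∑ x, (if x i = a then p.1 x else 0) = 1 := by
      intro i
      rw [Finset.sum_comm, ← p.2.2]
      simp
    rw [Finset.sum_congr rfl fun i _ => this i]
    have hn' : (n : ℝ) ≠ 0 := by positivity
    simp [hn']⟩

theorem avgMarginal_mean {n : ℕ} (hn : 0 < n) (p : stdSimplex ℝ (Fin n → X)) (f : X → ℝ) :
    ∑ x, p.1 x * ∑ i, f (x i) = n * ∑ a, (avgMarginal hn p).1 a * f a := by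
  classical
  have hn' : (n : ℝ) ≠ 0 := by positivity
  have h1 : ∀ a, n * ((avgMarginal hn p).1 a * f a)
      = ∑ i, ∑ x, if x i = a then p.1 x * f a else 0 := by
    intro a
    simp only [avgMarginal]
    rw [← mul_assoc, ← mul_assoc, mul_inv_cancel₀ hn', one_mul, Finset.sum_mul]
    refine Finset.sum_congr rfl fun i _ => ?_
    rw [Finset.sum_mul]
    refine Finset.sum_congr rfl fun x _ => ?_
    convert ite_zero_mul _ _ _
  rw [Finset.mul_sum, Finset.sum_congr rfl fun a _ => h1 a, Finset.sum_comm]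
  simp_rw [Finset.mul_sum]
  rw [Finset.sum_comm]
  refine Finset.sum_congr rfl fun i _ => ?_
  rw [Finset.sum_comm]
  simp

theorem avgMarginal_pos {n : ℕ} (hn : 0 < n) {p : stdSimplex ℝ (Fin n → X)} {x : Fin n → X}
    (hx : p.1 x ≠ 0) (i : Fin n) : (avgMarginal hn p).1 (x i) ≠ 0 := by
  classical
  have hx' : 0 < p.1 x := (p.2.1 x).lt_of_ne' hx
  refine (mul_pos (by positivity) ?_).ne'
  have h0 : ∀ j (y : Fin n → X), 0 ≤ if y j = x i then p.1 y else 0 := by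
    intro j y
    split_ifs
    · exact p.2.1 y
    · exact le_rfl
  refine Finset.sum_pos' (fun j _ => Finset.sum_nonneg fun y _ => by convert h0 j y)
    ⟨i, Finset.mem_univ i, Finset.sum_pos' (fun y _ => by convert h0 i y)
      ⟨x, Finset.mem_univ x, by simpa using hx'⟩⟩

theorem meanLog_iidSource {n : ℕ} (hn : 0 < n) {p : stdSimplex ℝ (Fin n → X)}
    {Q : stdSimplex ℝ X} (h : AbsCont p (iidSource Q n)) :
    meanLog p (iidSource Q n) = n * meanLog (avgMarginal hn p) Q := by
  rw [meanLog, meanLog, ← avgMarginal_mean]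
  refine Finset.sum_congr rfl fun x _ => ?_
  by_cases hx : p.1 x = 0
  · simp [hx]
  · rw [log_iidSource fun h' => hx (h x h')]

/-- Gibbs' inequality against the product of the averaged marginal gives subadditivity and concavity
of entropy in one stroke. -/
theorem entropy_le_avgMarginal {n : ℕ} (hn : 0 < n) (p : stdSimplex ℝ (Fin n → X)) :
    entropy p ≤ n * entropy (avgMarginal hn p) := by
  have h : AbsCont p (iidSource (avgMarginal hn p) n) := by
    intro x hx
    by_contra hp
    rw [iidSource_apply, Finset.prod_eq_zero_iff] at hx
    obtain ⟨i, _, hi⟩ := hx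
    exact avgMarginal_pos hn hp i hi
  have := entropy_le_neg_meanLog h
  rw [meanLog_iidSource hn h, meanLog_self] at this
  linarith

theorem avgMarginal_absCont {n : ℕ} (hn : 0 < n) {p : stdSimplex ℝ (Fin n → X)}
    {P : stdSimplex ℝ X} (h : AbsCont p (iidSource P n)) : AbsCont (avgMarginal hn p) P := by
  classical
  intro a ha
  simp only [avgMarginal]
  rw [Finset.sum_eq_zero, mul_zero]
  refine fun i _ => Finset.sum_eq_zero fun x _ => ?_
  split_ifs with hx
  · refine h x ?_
    rw [iidSource_apply]
    exact Finset.prod_eq_zero (Finset.mem_univ i) (by rw [hx, ha])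
  · rfl

theorem avgMarginal_iidSource {n : ℕ} (hn : 0 < n) (Q : stdSimplex ℝ X) :
    avgMarginal hn (iidSource Q n) = Q := by
  classical
  have hn' : (n : ℝ) ≠ 0 := by positivity
  refine Subtype.ext (funext fun a => ?_)
  have h : ∀ i : Fin n, (∑ x, if x i = a then (iidSource Q n).1 x else 0) = Q.1 a := by
    intro i
    have := iidSource_marginal Q i fun b => if b = a then 1 else 0
    simpa using this
  simp only [avgMarginal]
  have h2 : (∑ i : Fin n, ∑ x : Fin n → X, if x i = a then (iidSource Q n).1 x else 0)
      = n * Q.1 a := by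
    rw [Finset.sum_congr rfl fun i _ => h i]
    simp
  convert inv_mul_cancel_left₀ hn' (Q.1 a)

theorem iidSource_absCont {P Q : stdSimplex ℝ X} (h : AbsCont Q P) (n : ℕ) :
    AbsCont (iidSource Q n) (iidSource P n) := by
  intro x hx
  rw [iidSource_apply, Finset.prod_eq_zero_iff] at hx ⊢
  obtain ⟨i, hi, hx⟩ := hx
  exact ⟨i, hi, h _ hx⟩

theorem entropy_iidSource (Q : stdSimplex ℝ X) {n : ℕ} (hn : 0 < n) :
    entropy (iidSource Q n) = n * entropy Q := by
  have h := meanLog_iidSource hn (iidSource_absCont (fun _ h => h : AbsCont Q Q) n)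
  rw [meanLog_self, avgMarginal_iidSource, meanLog_self] at h
  linarith

theorem relEntropy_iidSource {P Q : stdSimplex ℝ X} (h : AbsCont Q P) {n : ℕ} (hn : 0 < n) :
    relEntropy (iidSource Q n) (iidSource P n)
      = ((n * (-entropy Q - meanLog Q P) : ℝ) : EReal) := by
  rw [relEntropy_of_absCont (iidSource_absCont h n), entropy_iidSource Q hn,
    meanLog_iidSource hn (iidSource_absCont h n), avgMarginal_iidSource]
  congr 1
  ring

/-! ### The weak law of large numbers, with exponential rate -/

theorem prob_mono (p : stdSimplex ℝ ι) {A B : Set ι} (h : A ⊆ B) : prob p A ≤ prob p B :=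
  Finset.sum_le_sum fun x _ => Set.indicator_le_indicator_of_subset h p.2.1 x

theorem prob_nonneg (p : stdSimplex ℝ ι) (A : Set ι) : 0 ≤ prob p A :=
  Finset.sum_nonneg fun x _ => Set.indicator_nonneg (fun y _ => p.2.1 y) x

theorem prob_compl (p : stdSimplex ℝ ι) (A : Set ι) : prob p Aᶜ = 1 - prob p A := by
  have h : prob p A + prob p Aᶜ = 1 := by
    rw [prob, prob, ← Finset.sum_add_distrib, ← p.2.2]
    exact Finset.sum_congr rfl fun x _ => congrFun (Set.indicator_self_add_compl A p.1) x
  linarith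

/-- The moment generating function is `1` at `0` and its derivative there is the mean, which is
negative. -/
theorem exists_expMoment_lt_one (Q : stdSimplex ℝ X) (f : X → ℝ) (hf : ∑ a, Q.1 a * f a < 0) :
    ∃ t > 0, ∑ a, Q.1 a * Real.exp (t * f a) < 1 := by
  have hd : HasDerivAt (fun t : ℝ => ∑ a, Q.1 a * Real.exp (t * f a)) (∑ a, Q.1 a * f a) 0 := by
    refine HasDerivAt.fun_sum fun a _ => ?_
    have h1 : HasDerivAt (fun t : ℝ => t * f a) (f a) 0 := by
      simpa using (hasDerivAt_id (0 : ℝ)).mul_const (f a)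
    simpa using h1.exp.const_mul (Q.1 a)
  have h2 := (hasDerivAt_iff_tendsto_slope_zero.1 hd).eventually (gt_mem_nhds hf)
  have h3 : ∀ᶠ t in 𝓝[>] (0 : ℝ),
      t⁻¹ • ((∑ a, Q.1 a * Real.exp ((0 + t) * f a)) - ∑ a, Q.1 a * Real.exp (0 * f a)) < 0 :=
    h2.filter_mono (nhdsWithin_mono _ fun t (ht : 0 < t) => ht.ne')
  obtain ⟨t, ht, ht0⟩ := (h3.and self_mem_nhdsWithin).exists
  have ht0 : 0 < t := ht0
  refine ⟨t, ht0, ?_⟩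
  simp only [zero_add, zero_mul, Real.exp_zero, mul_one, Q.2.2, smul_eq_mul] at ht
  have := (pos_iff_neg_of_mul_neg ht).1 (inv_pos.2 ht0)
  linarith

/-- Chernoff bound: the indicator is at most `exp (t (∑ f - n c))`, whose mean is the `n`-th power
of a number below `1`. -/
theorem tendsto_prob_iidSource (Q : stdSimplex ℝ X) (f : X → ℝ) {c : ℝ}
    (hc : ∑ a, Q.1 a * f a < c) :
    Tendsto (fun n => prob (iidSource Q n) {x | n * c ≤ ∑ i, f (x i)}) atTop (𝓝 0) := by
  obtain ⟨t, ht, h1⟩ := exists_expMoment_lt_one Q (fun a => f a - c) (by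
    simp only [mul_sub, Finset.sum_sub_distrib, ← Finset.sum_mul, Q.2.2]
    linarith)
  have h0 : 0 ≤ ∑ a, Q.1 a * Real.exp (t * (f a - c)) :=
    Finset.sum_nonneg fun a _ => mul_nonneg (Q.2.1 a) (Real.exp_pos _).le
  refine squeeze_zero (fun n => prob_nonneg _ _) (fun n => ?_)
    (tendsto_pow_atTop_nhds_zero_of_lt_one h0 h1)
  have h2 : (∑ a, Q.1 a * Real.exp (t * (f a - c))) ^ n
      = ∑ x : Fin n → X, (iidSource Q n).1 x * Real.exp (t * (∑ i, f (x i) - n * c)) := by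
    have := sum_prod_fin n fun _ a => Q.1 a * Real.exp (t * (f a - c))
    rw [Finset.prod_const, Finset.card_univ, Fintype.card_fin] at this
    rw [← this]
    refine Finset.sum_congr rfl fun x _ => ?_
    rw [Finset.prod_mul_distrib, iidSource_apply, ← Real.exp_sum, ← Finset.mul_sum,
      Finset.sum_sub_distrib]
    simp
  rw [h2, prob]
  refine Finset.sum_le_sum fun x _ => ?_
  by_cases hx : x ∈ {x : Fin n → X | n * c ≤ ∑ i, f (x i)}
  · rw [Set.indicator_of_mem hx]
    have hx' : n * c ≤ ∑ i, f (x i) := hx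
    exact le_mul_of_one_le_right ((iidSource Q n).2.1 x)
      (Real.one_le_exp (mul_nonneg ht.le (by linarith)))
  · rw [Set.indicator_of_notMem hx]
    exact mul_nonneg ((iidSource Q n).2.1 x) (Real.exp_pos _).le

/-! ### Rates of arbitrary sources -/

/-- Because `Real.log 0 = 0`, words of probability zero have self-information `0` and may violate
the inclusion; they carry no mass. -/
theorem prob_mono_support (p : stdSimplex ℝ ι) {A B : Set ι}
    (h : ∀ x ∈ A, p.1 x ≠ 0 → x ∈ B) : prob p A ≤ prob p B := by
  refine Finset.sum_le_sum fun x _ => ?_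
  by_cases hx : p.1 x = 0
  · have h0 : ∀ C : Set ι, C.indicator p.1 x = 0 := fun C =>
      Set.indicator_apply_eq_zero.2 fun _ => hx
    rw [h0, h0]
  by_cases hA : x ∈ A
  · rw [Set.indicator_of_mem hA, Set.indicator_of_mem (h x hA hx)]
  · rw [Set.indicator_of_notMem hA]
    exact Set.indicator_nonneg (fun y _ => p.2.1 y) x

theorem mul_selfInfoRate (Y : Source X) {n : ℕ} (hn : 0 < n) (x : Fin n → X) :
    n * selfInfoRate Y n x = -Real.log ((Y n).1 x) := by
  have hn' : (n : ℝ) ≠ 0 := by positivity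
  rw [selfInfoRate, mul_inv_cancel_left₀ hn', one_div, Real.log_inv]

theorem tendsto_prob_lt_selfInfoRate (Q : stdSimplex ℝ X) {t : ℝ} (ht : entropy Q < t) :
    Tendsto (fun n => prob (iidSource Q n) {x | t < selfInfoRate (iidSource Q) n x})
      atTop (𝓝 0) := by
  have h := tendsto_prob_iidSource Q (fun a => -Real.log (Q.1 a)) (c := t) (by
    have := meanLog_self Q
    rw [meanLog] at this
    simp only [mul_neg, Finset.sum_neg_distrib]
    linarith)
  refine squeeze_zero' (Eventually.of_forall fun n => prob_nonneg _ _) ?_ h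
  filter_upwards [eventually_gt_atTop 0] with n hn
  refine prob_mono_support _ fun x hx hx0 => ?_
  have hx' : t < selfInfoRate (iidSource Q) n x := hx
  have h1 : (n : ℝ) * t ≤ n * selfInfoRate (iidSource Q) n x := by gcongr
  rw [mul_selfInfoRate _ hn, log_iidSource hx0, ← Finset.sum_neg_distrib] at h1
  exact h1

theorem tendsto_prob_selfInfoRate_lt (Q : stdSimplex ℝ X) {t : ℝ} (ht : t < entropy Q) :
    Tendsto (fun n => prob (iidSource Q n) {x | selfInfoRate (iidSource Q) n x < t})
      atTop (𝓝 0) := by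
  have h := tendsto_prob_iidSource Q (fun a => Real.log (Q.1 a)) (c := -t) (by
    have := meanLog_self Q
    rw [meanLog] at this
    linarith)
  refine squeeze_zero' (Eventually.of_forall fun n => prob_nonneg _ _) ?_ h
  filter_upwards [eventually_gt_atTop 0] with n hn
  refine prob_mono_support _ fun x hx hx0 => ?_
  have hx' : selfInfoRate (iidSource Q) n x < t := hx
  have h1 : (n : ℝ) * selfInfoRate (iidSource Q) n x ≤ n * t := by gcongr
  rw [mul_selfInfoRate _ hn, log_iidSource hx0] at h1
  have h2 : (n : ℝ) * -t ≤ ∑ i, Real.log (Q.1 (x i)) := by linarith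
  exact h2

theorem spectralSupEntropyRate_iidSource_le (Q : stdSimplex ℝ X) :
    spectralSupEntropyRate (iidSource Q) ≤ entropy Q := by
  refine EReal.le_of_forall_lt_iff_le.1 fun t ht => ?_
  exact iInf₂_le t (tendsto_prob_lt_selfInfoRate Q (EReal.coe_lt_coe_iff.1 ht))

theorem le_spectralInfEntropyRate_iidSource (Q : stdSimplex ℝ X) :
    entropy Q ≤ spectralInfEntropyRate (iidSource Q) := by
  refine EReal.ge_of_forall_gt_iff_ge.1 fun t ht => ?_
  exact le_iSup₂ (f := fun (t : ℝ) (_ : Tendsto (fun n => prob (iidSource Q n)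
    {x | selfInfoRate (iidSource Q) n x < t}) atTop (𝓝 0)) => (t : EReal)) t
    (tendsto_prob_selfInfoRate_lt Q (EReal.coe_lt_coe_iff.1 ht))

theorem negMulLog_eq_selfInfoRate (Y : Source X) {n : ℕ} (hn : 0 < n) (x : Fin n → X) :
    Real.negMulLog ((Y n).1 x) = (Y n).1 x * (n * selfInfoRate Y n x) := by
  rw [mul_selfInfoRate Y hn, Real.negMulLog]
  ring

theorem le_one_of_mem (p : stdSimplex ℝ ι) (x : ι) : p.1 x ≤ 1 := by
  rw [← p.2.2]
  exact Finset.single_le_sum (fun y _ => p.2.1 y) (Finset.mem_univ x)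

theorem le_entropy (Y : Source X) {n : ℕ} (hn : 0 < n) (t : ℝ) :
    n * t * (1 - prob (Y n) {x | selfInfoRate Y n x < t}) ≤ entropy (Y n) := by
  rw [← prob_compl, prob, Finset.mul_sum, entropy]
  refine Finset.sum_le_sum fun x _ => ?_
  by_cases hx : x ∈ {x | selfInfoRate Y n x < t}ᶜ
  · rw [Set.indicator_of_mem hx, negMulLog_eq_selfInfoRate Y hn]
    have hx' : t ≤ selfInfoRate Y n x := not_lt.1 hx
    rw [mul_comm]
    have := (Y n).2.1 x
    gcongr
  · rw [Set.indicator_of_notMem hx, mul_zero]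
    exact Real.negMulLog_nonneg ((Y n).2.1 x) (le_one_of_mem _ x)

theorem negMulLog_le {p c : ℝ} (hp : 0 ≤ p) (hc : 0 < c) :
    Real.negMulLog p ≤ c - p * Real.log c := by
  rcases hp.eq_or_lt' with rfl | hp
  · simpa using hc.le
  · have h1 := Real.log_le_sub_one_of_pos (div_pos hc hp)
    rw [Real.log_div hc.ne' hp.ne'] at h1
    have h2 := mul_le_mul_of_nonneg_left h1 hp.le
    have h3 : p * (c / p - 1) = c - p := by field_simp
    rw [Real.negMulLog]
    linarith

/-- Words above the threshold may have unbounded self-information. Comparing them with the uniform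
weight `c` by `negMulLog_le` charges each at most `n ln |X|` per unit of mass, plus `c`; these
extras sum to at most `1`. -/
theorem entropy_le (Y : Source X) {n : ℕ} (hn : 0 < n) (t : ℝ) :
    entropy (Y n) ≤ n * t * (1 - prob (Y n) {x | t < selfInfoRate Y n x}) + 1
      + n * Real.log (Fintype.card X) * prob (Y n) {x | t < selfInfoRate Y n x} := by
  obtain ⟨x₀, _⟩ := exists_pos (Y n)
  have hX : 0 < (Fintype.card X : ℝ) := Nat.cast_pos.2 (Fintype.card_pos_iff.2 ⟨x₀ ⟨0, hn⟩⟩)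
  set c : ℝ := ((Fintype.card X : ℝ) ^ n)⁻¹ with hc
  have hc0 : 0 < c := by positivity
  have hlog : Real.log c = -(n * Real.log (Fintype.card X)) := by
    rw [hc, Real.log_inv, Real.log_pow]
  have hsum : ∑ _x : Fin n → X, c = 1 := by
    rw [Finset.sum_const, Finset.card_univ, Fintype.card_fun, Fintype.card_fin, nsmul_eq_mul, hc,
      Nat.cast_pow, mul_inv_cancel₀ (by positivity)]
  rw [← prob_compl, prob, prob, Finset.mul_sum, Finset.mul_sum, ← hsum, ← Finset.sum_add_distrib,
    ← Finset.sum_add_distrib, entropy]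
  refine Finset.sum_le_sum fun x _ => ?_
  by_cases hx : x ∈ {x | t < selfInfoRate Y n x}
  · rw [Set.indicator_of_mem hx, Set.indicator_of_notMem (by simpa using hx)]
    have := negMulLog_le ((Y n).2.1 x) hc0
    rw [hlog] at this
    linarith
  · rw [Set.indicator_of_notMem hx, Set.indicator_of_mem hx, negMulLog_eq_selfInfoRate Y hn]
    have hx' : selfInfoRate Y n x ≤ t := not_lt.1 hx
    have h1 : (Y n).1 x * (n * selfInfoRate Y n x) ≤ (Y n).1 x * (n * t) := by
      have := (Y n).2.1 x
      gcongr
    linarith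

theorem eventually_lt_entropy {Y : Source X} {R : ℝ}
    (h : (R : EReal) < spectralInfEntropyRate Y) : ∀ᶠ n : ℕ in atTop, n * R < entropy (Y n) := by
  obtain ⟨t, ht⟩ := lt_iSup_iff.1 h
  obtain ⟨hlim, ht⟩ := lt_iSup_iff.1 ht
  have ht : R < t := EReal.coe_lt_coe_iff.1 ht
  have h1 : Tendsto (fun n => t * (1 - prob (Y n) {x | selfInfoRate Y n x < t})) atTop (𝓝 t) := by
    simpa using (hlim.const_sub 1).const_mul t
  filter_upwards [h1.eventually (lt_mem_nhds ht), eventually_gt_atTop 0] with n h2 hn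
  refine lt_of_lt_of_le ?_ (le_entropy Y hn t)
  rw [mul_assoc]
  have hn' : (0 : ℝ) < n := by positivity
  gcongr

theorem eventually_entropy_lt {Y : Source X} {R : ℝ}
    (h : spectralSupEntropyRate Y < (R : EReal)) : ∀ᶠ n : ℕ in atTop, entropy (Y n) < n * R := by
  obtain ⟨t, ht⟩ := iInf_lt_iff.1 h
  obtain ⟨hlim, ht⟩ := iInf_lt_iff.1 ht
  have ht : t < R := EReal.coe_lt_coe_iff.1 ht
  have h1 : Tendsto (fun n : ℕ => t * (1 - prob (Y n) {x | t < selfInfoRate Y n x}) + (n : ℝ)⁻¹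
      + Real.log (Fintype.card X) * prob (Y n) {x | t < selfInfoRate Y n x}) atTop (𝓝 t) := by
    simpa using (((hlim.const_sub 1).const_mul t).add (tendsto_inv_atTop_nhds_zero_nat (𝕜 := ℝ))).add
      (hlim.const_mul (Real.log (Fintype.card X)))
  filter_upwards [h1.eventually (gt_mem_nhds ht), eventually_gt_atTop 0] with n h2 hn
  refine lt_of_le_of_lt (entropy_le Y hn t) ?_
  have hn' : (0 : ℝ) < n := by positivity
  have h3 := mul_lt_mul_of_pos_left h2 hn'
  have h4 : (n : ℝ) * (n : ℝ)⁻¹ = 1 := mul_inv_cancel₀ hn'.ne'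
  rw [mul_add, mul_add, h4] at h3
  linarith

/-! ### Single-letter evaluation of the terms of the general bounds -/

theorem relEntropy_avgMarginal_le (P : stdSimplex ℝ X) {n : ℕ} (hn : 0 < n)
    (p : stdSimplex ℝ (Fin n → X)) :
    relEntropy (avgMarginal hn p) P ≤ (((n : ℝ)⁻¹ : ℝ) : EReal) * relEntropy p (iidSource P n) := by
  have hn' : (0 : ℝ) < n := by positivity
  by_cases h : AbsCont p (iidSource P n)
  · rw [relEntropy_of_absCont h, relEntropy_of_absCont (avgMarginal_absCont hn h),
      ← EReal.coe_mul, EReal.coe_le_coe_iff, meanLog_iidSource hn h, ← div_eq_inv_mul,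
      le_div_iff₀ hn']
    linarith [entropy_le_avgMarginal hn p]
  · rw [relEntropy_of_not_absCont h, EReal.coe_mul_top_of_pos (by positivity)]
    exact le_top

theorem upperDivergence_iidSource {P Q : stdSimplex ℝ X} (h : AbsCont Q P) :
    upperDivergence (iidSource Q) (iidSource P) = relEntropy Q P := by
  refine Tendsto.limsup_eq (tendsto_const_nhds.congr' ?_)
  filter_upwards [eventually_gt_atTop 0] with n hn
  have hn' : (n : ℝ) ≠ 0 := by positivity
  rw [relEntropy_iidSource h hn, ← EReal.coe_mul, inv_mul_cancel_left₀ hn',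
    relEntropy_of_absCont h]

/-- Iid sources give one inequality. For the other, a spectral rate above `R` forces entropy above
`n R` eventually, so the averaged marginal is admissible and has no larger normalized divergence. -/
theorem errorExponentBound_iidSource (P : stdSimplex ℝ X) (R : ℝ) :
    errorExponentBound (iidSource P) R
      = ⨅ (Q : stdSimplex ℝ X) (_ : R < entropy Q), relEntropy Q P := by
  refine le_antisymm (le_iInf₂ fun Q hQ => ?_) (le_iInf₂ fun Y hY => ?_)
  · by_cases h : AbsCont Q P
    · rw [← upperDivergence_iidSource h]
      exact iInf₂_le (iidSource Q)
        ((EReal.coe_lt_coe_iff.2 hQ).trans_le (le_spectralInfEntropyRate_iidSource Q))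
    · rw [relEntropy_of_not_absCont h]
      exact le_top
  · refine le_limsup_of_frequently_le (Eventually.frequently ?_)
    filter_upwards [eventually_lt_entropy hY, eventually_gt_atTop 0] with n h1 hn
    refine le_trans (iInf₂_le (avgMarginal hn (Y n)) ?_) (relEntropy_avgMarginal_le P hn (Y n))
    have hn' : (0 : ℝ) < n := by positivity
    exact (mul_lt_mul_iff_right₀ hn').1 (h1.trans_le (entropy_le_avgMarginal hn (Y n)))

/-- The entropy rate of `Y` is kept rather than bounded by that of the averaged marginal, since
`correctDecodingBound_le` needs both that bound and the spectral constraint. -/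
theorem tiltedRate_of_absCont {Y : Source X} {P : stdSimplex ℝ X} {n : ℕ} (hn : 0 < n)
    (h : AbsCont (Y n) (iidSource P n)) (θ : ℝ) :
    tiltedRate Y (iidSource P) θ n
      = (((1 + θ) * (entropy (Y n) / n) + meanLog (avgMarginal hn (Y n)) P : ℝ) : EReal) := by
  have hn' : (n : ℝ) ≠ 0 := by positivity
  rw [tiltedRate, relEntropy_of_absCont h, ← EReal.coe_sub, ← EReal.coe_mul, EReal.coe_eq_coe_iff,
    meanLog_iidSource hn h]
  field_simp
  ring

theorem tiltedRate_of_not_absCont {Y S : Source X} {n : ℕ} (hn : 0 < n)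
    (h : ¬ AbsCont (Y n) (S n)) (θ : ℝ) : tiltedRate Y S θ n = ⊥ := by
  rw [tiltedRate, coe_sub_relEntropy_of_not_absCont h, EReal.coe_mul_bot_of_pos (by positivity)]

theorem tendsto_tiltedRate_iidSource {P Q : stdSimplex ℝ X} (h : AbsCont Q P) (θ : ℝ) :
    Tendsto (tiltedRate (iidSource Q) (iidSource P) θ) atTop
      (𝓝 (((θ * entropy Q : ℝ) : EReal) - relEntropy Q P)) := by
  refine tendsto_const_nhds.congr' ?_
  filter_upwards [eventually_gt_atTop 0] with n hn
  have hn' : (n : ℝ) ≠ 0 := by positivity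
  rw [tiltedRate_of_absCont hn (iidSource_absCont h n), relEntropy_of_absCont h, ← EReal.coe_sub,
    EReal.coe_eq_coe_iff, avgMarginal_iidSource, entropy_iidSource Q hn]
  field_simp
  ring

theorem le_correctDecodingBound (P : stdSimplex ℝ X) (R ρ : ℝ) :
    (⨆ (Q : stdSimplex ℝ X) (_ : entropy Q ≤ R), ((ρ * entropy Q : ℝ) : EReal) - relEntropy Q P)
      ≤ correctDecodingBound (iidSource P) R ρ := by
  refine iSup₂_le fun Q hQ => ?_
  by_cases h : AbsCont Q P
  · rw [← (tendsto_tiltedRate_iidSource h ρ).liminf_eq]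
    exact le_iSup₂ (f := fun (Y : Source X) (_ : spectralSupEntropyRate Y ≤ (R : EReal)) =>
      lowerTiltedRate Y (iidSource P) ρ) (iidSource Q)
      ((spectralSupEntropyRate_iidSource_le Q).trans (EReal.coe_le_coe_iff.2 hQ))
  · rw [coe_sub_relEntropy_of_not_absCont h]
    exact bot_le

theorem tiltedRate_le (Y : Source X) (P : stdSimplex ℝ X) {θ : ℝ} (hθ : 0 ≤ θ) {n : ℕ}
    (hn : 0 < n) :
    tiltedRate Y (iidSource P) θ n ≤ (((1 + θ) * Real.log (tiltSum P θ) : ℝ) : EReal) := by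
  by_cases h : AbsCont (Y n) (iidSource P n)
  · rw [tiltedRate_of_absCont hn h, EReal.coe_le_coe_iff]
    refine le_trans ?_ (tilt_bound hθ (avgMarginal_absCont hn h))
    have hn' : (0 : ℝ) < n := by positivity
    have := (div_le_iff₀' hn').2 (entropy_le_avgMarginal hn (Y n))
    gcongr
  · rw [tiltedRate_of_not_absCont hn h]
    exact bot_le

theorem coe_sub_relEntropy_tilted (P : stdSimplex ℝ X) {θ : ℝ} (hθ : 0 ≤ θ) :
    ((θ * entropy (tilted P θ) : ℝ) : EReal) - relEntropy (tilted P θ) P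
      = (((1 + θ) * Real.log (tiltSum P θ) : ℝ) : EReal) := by
  rw [relEntropy_of_absCont (absCont_tilted hθ), ← EReal.coe_sub, EReal.coe_eq_coe_iff,
    ← tilt_eq P hθ]
  ring

theorem iSup_tilt (P : stdSimplex ℝ X) {θ : ℝ} (hθ : 0 ≤ θ) :
    (⨆ Q : stdSimplex ℝ X, ((θ * entropy Q : ℝ) : EReal) - relEntropy Q P)
      = (((1 + θ) * Real.log (tiltSum P θ) : ℝ) : EReal) := by
  refine le_antisymm (iSup_le fun Q => ?_) ?_
  · by_cases h : AbsCont Q P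
    · rw [relEntropy_of_absCont h, ← EReal.coe_sub, EReal.coe_le_coe_iff]
      linarith [tilt_bound hθ h]
    · rw [coe_sub_relEntropy_of_not_absCont h]
      exact bot_le
  · rw [← coe_sub_relEntropy_tilted P hθ]
    exact le_iSup (fun Q => ((θ * entropy Q : ℝ) : EReal) - relEntropy Q P) (tilted P θ)

theorem isGreatest_upperTiltedRate (P : stdSimplex ℝ X) {θ : ℝ} (hθ : 0 ≤ θ) :
    IsGreatest (Set.range fun Y : Source X => upperTiltedRate Y (iidSource P) θ)
      (⨆ Q : stdSimplex ℝ X, ((θ * entropy Q : ℝ) : EReal) - relEntropy Q P) := by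
  rw [iSup_tilt P hθ]
  constructor
  · refine ⟨iidSource (tilted P θ), ?_⟩
    rw [← coe_sub_relEntropy_tilted P hθ]
    exact (tendsto_tiltedRate_iidSource (absCont_tilted hθ) θ).limsup_eq
  · rintro _ ⟨Y, rfl⟩
    refine limsup_le_of_le (h := ?_)
    filter_upwards [eventually_gt_atTop 0] with n hn using tiltedRate_le Y P hθ hn

theorem upperBoundAt_iidSource (P : stdSimplex ℝ X) (R ρ : ℝ) {θ : ℝ} (hθ : 0 ≤ θ) :
    upperBoundAt (iidSource P) R ρ θ
      = (((ρ - θ) * R + (1 + θ) * Real.log (tiltSum P θ) : ℝ) : EReal) := by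
  rw [upperBoundAt, ← sSup_range, (isGreatest_upperTiltedRate P hθ).isLUB.sSup_eq, iSup_tilt P hθ,
    ← EReal.coe_add]

/-! ### The single-letter exponent -/

theorem singleLetter_le {P Q : stdSimplex ℝ X} (h : AbsCont Q P) (R : ℝ) {ρ θ : ℝ}
    (hθ : θ ∈ Set.Icc 0 ρ) :
    ρ * min (entropy Q) R + entropy Q + meanLog Q P
      ≤ (ρ - θ) * R + (1 + θ) * Real.log (tiltSum P θ) := by
  have h1 := tilt_bound hθ.1 h
  have h2 := mul_le_mul_of_nonneg_left (min_le_left (entropy Q) R) hθ.1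
  have h3 := mul_le_mul_of_nonneg_left (min_le_right (entropy Q) R) (sub_nonneg.2 hθ.2)
  linarith

theorem singleLetterValue_of_absCont {P Q : stdSimplex ℝ X} (h : AbsCont Q P) (R ρ : ℝ) :
    singleLetterValue P R ρ Q
      = ((ρ * min (entropy Q) R + entropy Q + meanLog Q P : ℝ) : EReal) := by
  rw [singleLetterValue, relEntropy_of_absCont h, ← EReal.coe_sub, EReal.coe_eq_coe_iff]
  ring

theorem singleLetterValue_le (P Q : stdSimplex ℝ X) (R : ℝ) {ρ θ : ℝ} (hθ : θ ∈ Set.Icc 0 ρ) :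
    singleLetterValue P R ρ Q
      ≤ (((ρ - θ) * R + (1 + θ) * Real.log (tiltSum P θ) : ℝ) : EReal) := by
  by_cases h : AbsCont Q P
  · rw [singleLetterValue_of_absCont h, EReal.coe_le_coe_iff]
    exact singleLetter_le h R hθ
  · rw [singleLetterValue, coe_sub_relEntropy_of_not_absCont h]
    exact bot_le

theorem singleLetterExponent_eq {P Q : stdSimplex ℝ X} {R ρ v : ℝ}
    (hle : ∀ Q, singleLetterValue P R ρ Q ≤ v) (hQ : singleLetterValue P R ρ Q = v) :
    singleLetterExponent P R ρ = v :=
  le_antisymm (iSup_le hle) (hQ ▸ le_iSup (singleLetterValue P R ρ) Q)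

/-! ### The two general bounds at a saddle point -/

theorem generalUpperBound_eq {P Q : stdSimplex ℝ X} {R ρ θ v : ℝ} (hθ : θ ∈ Set.Icc 0 ρ)
    (hQ : singleLetterValue P R ρ Q = v)
    (hv : v = (ρ - θ) * R + (1 + θ) * Real.log (tiltSum P θ)) :
    generalUpperBound (iidSource P) R ρ = v := by
  refine le_antisymm ?_ (le_iInf₂ fun θ' hθ' => ?_)
  · rw [hv, ← upperBoundAt_iidSource P R ρ hθ.1]
    exact iInf₂_le θ hθ
  · rw [← hQ, upperBoundAt_iidSource P R ρ hθ'.1]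
    exact singleLetterValue_le P Q R hθ'

theorem correctDecodingBound_le {P : stdSimplex ℝ X} {R ρ v : ℝ} (hρ : 0 < ρ)
    (hle : ∀ Q, singleLetterValue P R ρ Q ≤ v) :
    correctDecodingBound (iidSource P) R ρ ≤ v := by
  refine iSup₂_le fun Y hY => ?_
  by_contra! hlt
  obtain ⟨c, hvc, hc⟩ := EReal.lt_iff_exists_real_btwn.1 hlt
  have hvc : v < c := EReal.coe_lt_coe_iff.1 hvc
  -- The constraint on `Y` only yields entropy below `n (R + ε)`; this slack costs `ρ ε`, chosen to
  -- equal the gap `c - v`.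
  set ε := (c - v) / ρ with hε
  have hε0 : 0 < ε := div_pos (sub_pos.2 hvc) hρ
  have h1 : spectralSupEntropyRate Y < ((R + ε : ℝ) : EReal) :=
    hY.trans_lt (EReal.coe_lt_coe_iff.2 (by linarith))
  obtain ⟨n, ⟨h2, h3⟩, hn⟩ := (((eventually_entropy_lt h1).and
    (eventually_lt_of_lt_liminf hc)).and (eventually_gt_atTop 0)).exists
  have hn' : (0 : ℝ) < n := by positivity
  by_cases h : AbsCont (Y n) (iidSource P n)
  · rw [tiltedRate_of_absCont hn h, EReal.coe_lt_coe_iff] at h3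
    have h4 := hle (avgMarginal hn (Y n))
    rw [singleLetterValue_of_absCont (avgMarginal_absCont hn h), EReal.coe_le_coe_iff] at h4
    have h5 := (div_le_iff₀' hn').2 (entropy_le_avgMarginal hn (Y n))
    have h6 := (div_lt_iff₀' hn').2 h2
    have h7 : entropy (Y n) / n ≤ min (entropy (avgMarginal hn (Y n))) R + ε := by
      rw [← sub_le_iff_le_add]
      exact le_min (by linarith) (by linarith)
    have h8 := mul_le_mul_of_nonneg_left h7 hρ.le
    have h9 : ρ * ε = c - v := by rw [hε]; field_simp
    linarith
  · rw [tiltedRate_of_not_absCont hn h] at h3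
    exact not_lt_bot h3

/-- The maximizing `Q` is admissible in the first term if its entropy exceeds `R`, and otherwise in
the second. -/
theorem generalLowerBound_eq {P Q : stdSimplex ℝ X} {R ρ v : ℝ} (hρ : 0 < ρ)
    (hle : ∀ Q, singleLetterValue P R ρ Q ≤ v) (hQ : singleLetterValue P R ρ Q = v) :
    generalLowerBound (iidSource P) R ρ = v := by
  refine le_antisymm (max_le ?_ (correctDecodingBound_le hρ hle)) ?_
  · have h1 : ((ρ * R - v : ℝ) : EReal) ≤ errorExponentBound (iidSource P) R := by
      rw [errorExponentBound_iidSource P R]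
      refine le_iInf₂ fun Q' hQ' => ?_
      by_cases h : AbsCont Q' P
      · have h2 := hle Q'
        rw [singleLetterValue_of_absCont h, EReal.coe_le_coe_iff, min_eq_right hQ'.le] at h2
        rw [relEntropy_of_absCont h, EReal.coe_le_coe_iff]
        linarith
      · rw [relEntropy_of_not_absCont h]
        exact le_top
    calc ((ρ * R : ℝ) : EReal) - errorExponentBound (iidSource P) R
        ≤ ((ρ * R : ℝ) : EReal) - ((ρ * R - v : ℝ) : EReal) := EReal.sub_le_sub le_rfl h1
      _ = v := by rw [← EReal.coe_sub, sub_sub_cancel]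
  · rw [← hQ]
    by_cases h : R < entropy Q
    · refine le_max_of_le_left ?_
      rw [singleLetterValue, min_eq_right h.le, errorExponentBound_iidSource P R]
      exact EReal.sub_le_sub le_rfl (iInf₂_le Q h)
    · push Not at h
      refine le_max_of_le_right (le_trans ?_ (le_correctDecodingBound P R ρ))
      rw [singleLetterValue, min_eq_left h]
      exact le_iSup₂ (f := fun (Q : stdSimplex ℝ X) (_ : entropy Q ≤ R) =>
        ((ρ * entropy Q : ℝ) : EReal) - relEntropy Q P) Q h

/-! ### Exponential rates -/

theorem tendsto_of_eventually_coe {a : ℕ → EReal} {v : ℝ}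
    (hl : ∀ ε > 0, ∀ᶠ n in atTop, ((v - ε : ℝ) : EReal) ≤ a n)
    (hu : ∀ ε > 0, ∀ᶠ n in atTop, a n ≤ ((v + ε : ℝ) : EReal)) :
    Tendsto a atTop (𝓝 (v : EReal)) := by
  refine tendsto_order.2 ⟨fun b hb => ?_, fun b hb => ?_⟩
  · obtain ⟨c, hbc, hc⟩ := EReal.lt_iff_exists_real_btwn.1 hb
    filter_upwards [hl (v - c) (sub_pos.2 (EReal.coe_lt_coe_iff.1 hc))] with n hn
    rw [sub_sub_cancel] at hn
    exact hbc.trans_le hn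
  · obtain ⟨c, hc, hbc⟩ := EReal.lt_iff_exists_real_btwn.1 hb
    filter_upwards [hu (c - v) (sub_pos.2 (EReal.coe_lt_coe_iff.1 hc))] with n hn
    rw [add_sub_cancel] at hn
    exact hn.trans_lt hbc

theorem eventually_le_rate {K : ℝ} (hK : 0 < K) (w : ℝ) {ε : ℝ} (hε : 0 < ε) :
    ∀ᶠ n : ℕ in atTop, ∀ c : ℝ, K * Real.exp (n * w) ≤ c → w - ε ≤ (n : ℝ)⁻¹ * Real.log c := by
  have h1 : Tendsto (fun n : ℕ => (n : ℝ)⁻¹ * Real.log K) atTop (𝓝 0) := by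
    simpa using (tendsto_inv_atTop_nhds_zero_nat (𝕜 := ℝ)).mul_const (Real.log K)
  filter_upwards [h1.eventually (lt_mem_nhds (neg_lt_zero.2 hε)), eventually_gt_atTop 0]
    with n h2 hn c hc
  have hn' : (0 : ℝ) < n := by positivity
  have h3 := Real.log_le_log (by positivity) hc
  rw [Real.log_mul hK.ne' (Real.exp_pos _).ne', Real.log_exp] at h3
  have h4 := mul_le_mul_of_nonneg_left h3 (inv_pos.2 hn').le
  rw [mul_add, inv_mul_cancel_left₀ hn'.ne'] at h4
  linarith

theorem eventually_rate_le {K : ℝ} (hK : 0 < K) (w : ℝ) {ε : ℝ} (hε : 0 < ε) :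
    ∀ᶠ n : ℕ in atTop, ∀ c : ℝ, 0 < c → c ≤ K * Real.exp (n * w) →
      (n : ℝ)⁻¹ * Real.log c ≤ w + ε := by
  have h1 : Tendsto (fun n : ℕ => (n : ℝ)⁻¹ * Real.log K) atTop (𝓝 0) := by
    simpa using (tendsto_inv_atTop_nhds_zero_nat (𝕜 := ℝ)).mul_const (Real.log K)
  filter_upwards [h1.eventually (gt_mem_nhds hε), eventually_gt_atTop 0] with n h2 hn c hc0 hc
  have hn' : (0 : ℝ) < n := by positivity
  have h3 := Real.log_le_log hc0 hc
  rw [Real.log_mul hK.ne' (Real.exp_pos _).ne', Real.log_exp] at h3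
  have h4 := mul_le_mul_of_nonneg_left h3 (inv_pos.2 hn').le
  rw [mul_add, inv_mul_cancel_left₀ hn'.ne'] at h4
  linarith

/-! ### Change of measure -/

/-- Law of large numbers for the log-likelihood ratio, whose mean under `Q` is `D(Q‖P)`. -/
theorem tendsto_prob_likelihood {P Q : stdSimplex ℝ X} (h : AbsCont Q P) {ε : ℝ} (hε : 0 < ε) :
    Tendsto (fun n : ℕ => prob (iidSource Q n) {x | (iidSource P n).1 x
      < Real.exp (-(n * (-entropy Q - meanLog Q P + ε))) * (iidSource Q n).1 x}) atTop (𝓝 0) := by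
  have hlim := tendsto_prob_iidSource Q (fun a => Real.log (Q.1 a) - Real.log (P.1 a))
    (c := -entropy Q - meanLog Q P + ε) (by
      rw [← meanLog_self, meanLog, meanLog, ← Finset.sum_sub_distrib]
      simp only [mul_sub]
      linarith)
  refine squeeze_zero (fun n => prob_nonneg _ _) (fun n => ?_) hlim
  refine prob_mono_support _ fun x hx hx0 => ?_
  have hP0 : (iidSource P n).1 x ≠ 0 := fun h' => hx0 (iidSource_absCont h n x h')
  have hx' := Real.log_lt_log (((iidSource P n).2.1 x).lt_of_ne' hP0) hx
  rw [Real.log_mul (Real.exp_pos _).ne' hx0, Real.log_exp, log_iidSource hP0,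
    log_iidSource hx0] at hx'
  change (n : ℝ) * _ ≤ ∑ i, (Real.log (Q.1 (x i)) - Real.log (P.1 (x i)))
  rw [Finset.sum_sub_distrib]
  linarith

/-- A function that exceeds `B` with high probability under `Q ^ n` has a moment of at least about
`exp (-n D(Q ‖ P)) B` under `P ^ n`. -/
theorem eventually_le_moment {P Q : stdSimplex ℝ X} (h : AbsCont Q P) {ε : ℝ} (hε : 0 < ε)
    {δ : ℕ → ℝ} (hδ : Tendsto δ atTop (𝓝 0)) :
    ∀ᶠ n : ℕ in atTop, ∀ (φ ψ : (Fin n → X) → ℝ) (B : ℝ), 0 ≤ B → (∀ x, 0 ≤ φ x) →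
      (∀ x, 0 ≤ ψ x) → (∀ x, B * (1 - ψ x) ≤ φ x) → ∑ x, (iidSource Q n).1 x * ψ x ≤ δ n →
      1 / 2 * (Real.exp (-(n * (-entropy Q - meanLog Q P + ε))) * B)
        ≤ ∑ x, (iidSource P n).1 x * φ x := by
  have hlim := hδ.add (tendsto_prob_likelihood h hε)
  rw [add_zero] at hlim
  filter_upwards [hlim.eventually (gt_mem_nhds (by norm_num : (0 : ℝ) < 1 / 2))]
    with n hn φ ψ B hB hφ hψ hφψ hsum
  set E := Real.exp (-(n * (-entropy Q - meanLog Q P + ε))) with hE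
  have hE0 : 0 < E := Real.exp_pos _
  set A : Set (Fin n → X) := {x | (iidSource P n).1 x < E * (iidSource Q n).1 x} with hA
  -- Off `A` the likelihood bound applies; on `A` the left side is nonpositive.
  have key : ∀ x, E * B * ((iidSource Q n).1 x - (iidSource Q n).1 x * ψ x
      - A.indicator (iidSource Q n).1 x) ≤ (iidSource P n).1 x * φ x := by
    intro x
    have hP := (iidSource P n).2.1 x
    have hQ := (iidSource Q n).2.1 x
    by_cases hx : x ∈ A
    · rw [Set.indicator_of_mem hx]
      have h1 := mul_nonneg (mul_nonneg hE0.le hB) (mul_nonneg hQ (hψ x))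
      have h2 := mul_nonneg hP (hφ x)
      linarith
    · rw [Set.indicator_of_notMem hx]
      have hx' : E * (iidSource Q n).1 x ≤ (iidSource P n).1 x := not_lt.1 hx
      have h1 := mul_le_mul_of_nonneg_right hx' (hφ x)
      have h2 := mul_le_mul_of_nonneg_left (hφψ x) (mul_nonneg hE0.le hQ)
      linarith
  refine le_trans ?_ (Finset.sum_le_sum fun x _ => key x)
  rw [← Finset.mul_sum, Finset.sum_sub_distrib, Finset.sum_sub_distrib, (iidSource Q n).2.2]
  rw [prob] at hn
  rw [mul_comm]
  exact mul_le_mul_of_nonneg_left (by linarith) (by positivity)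

/-- The probability bound used for the untypical events in both converse arguments. -/
def untypicalBound (Q : stdSimplex ℝ X) (ε : ℝ) (n : ℕ) : ℝ :=
  prob (iidSource Q n) {x | selfInfoRate (iidSource Q) n x < entropy Q - ε / 2}
    + 2 * Real.exp (-(n * (ε / 2)))

theorem tendsto_untypicalBound (Q : stdSimplex ℝ X) {ε : ℝ} (hε : 0 < ε) :
    Tendsto (untypicalBound Q ε) atTop (𝓝 0) := by
  have h1 : Tendsto (fun n : ℕ => Real.exp (-((n : ℝ) * (ε / 2)))) atTop (𝓝 0) :=
    Real.tendsto_exp_neg_atTop_nhds_zero.comp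
      (tendsto_natCast_atTop_atTop.atTop_mul_const (half_pos hε))
  have h2 := (tendsto_prob_selfInfoRate_lt Q (sub_lt_self (entropy Q) (half_pos hε))).add
    (h1.const_mul 2)
  rw [mul_zero, add_zero] at h2
  exact h2

theorem le_exp_of_le_selfInfoRate {Y : Source X} {n : ℕ} (hn : 0 < n) {t : ℝ} {x : Fin n → X}
    (h : t ≤ selfInfoRate Y n x) : (Y n).1 x ≤ Real.exp (-(n * t)) := by
  rcases ((Y n).2.1 x).eq_or_lt' with h0 | h0
  · rw [h0]
    positivity
  · rw [← Real.log_le_iff_le_exp h0]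
    have h1 : (n : ℝ) * t ≤ n * selfInfoRate Y n x := by gcongr
    rw [mul_selfInfoRate Y hn] at h1
    linarith

/-- The converse shared by compression and guessing: `φ` is the cost of a message and `ψ` the
conditional probability that the cost is small. -/
theorem eventually_le_rate_of_moment {P Q : stdSimplex ℝ X} (h : AbsCont Q P) (R : ℝ) {ρ ε : ℝ}
    (hρ : 0 < ρ) (hε : 0 < ε) :
    ∃ η > 0, ∀ᶠ n : ℕ in atTop, ∀ φ ψ : (Fin n → X) → ℝ, (∀ x, 0 ≤ φ x) → (∀ x, 0 ≤ ψ x) →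
      (∀ x, Real.exp (ρ * (n * (min (entropy Q) R - η))) * (1 - ψ x) ≤ φ x) →
      ∑ x, (iidSource Q n).1 x * ψ x ≤ untypicalBound Q η n →
      ρ * min (entropy Q) R + entropy Q + meanLog Q P - ε
        ≤ (n : ℝ)⁻¹ * Real.log (∑ x, (iidSource P n).1 x * φ x) := by
  -- The budget: `ρ η` is lost in the threshold, `η` in the change of measure, and `ε / 2` absorbs
  -- the factor `1 / 2`.
  have hη : 0 < ε / (2 * (1 + ρ)) := by positivity
  set η := ε / (2 * (1 + ρ)) with hη'
  have hηε : ε / 2 = (1 + ρ) * η := by rw [hη']; field_simp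
  refine ⟨η, hη, ?_⟩
  filter_upwards [eventually_le_moment h hη (tendsto_untypicalBound Q hη),
    eventually_le_rate (K := 1 / 2) (by norm_num)
      (ρ * min (entropy Q) R + entropy Q + meanLog Q P - ε / 2) (half_pos hε)]
    with n h1 h2 φ ψ hφ hψ hφψ hsum
  have h3 := h1 φ ψ _ (Real.exp_pos _).le hφ hψ hφψ hsum
  refine le_trans (le_of_eq (by ring)) (h2 _ (le_trans (le_of_eq ?_) h3))
  rw [← Real.exp_add, hηε]
  congr 2
  ring

/-! ### The compression exponent -/

theorem tiltSum_iidSource (P : stdSimplex ℝ X) (θ : ℝ) (n : ℕ) :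
    tiltSum (iidSource P n) θ = tiltSum P θ ^ n := by
  have h := sum_prod_fin n fun _ a => P.1 a ^ (1 + θ)⁻¹
  rw [Finset.prod_const, Finset.card_univ, Fintype.card_fin] at h
  rw [tiltSum, tiltSum, ← h]
  refine Finset.sum_congr rfl fun x _ => ?_
  rw [iidSource_apply, Real.finsetProd_rpow _ _ fun i _ => P.2.1 (x i)]

theorem tiltSum_iidSource_rpow (P : stdSimplex ℝ X) (θ : ℝ) (n : ℕ) :
    tiltSum (iidSource P n) θ ^ (1 + θ) = Real.exp (n * ((1 + θ) * Real.log (tiltSum P θ))) := by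
  rw [Real.rpow_def_of_pos (tiltSum_pos _ _), tiltSum_iidSource, Real.log_pow]
  congr 1
  ring

/-- The exponent of `p` is `1 - θ/(1+θ) = 1/(1+θ)`. This turns both the code length moment and the
guessing moment into power sums. -/
theorem mul_rpow_tilt {p Z θ : ℝ} (hp : 0 < p) (hθ : 0 ≤ θ) (hZ : 0 < Z) :
    p * (Z / p ^ (1 + θ)⁻¹) ^ θ = p ^ (1 + θ)⁻¹ * Z ^ θ := by
  have h1 : 1 + θ ≠ 0 := by positivity
  rw [Real.div_rpow hZ.le (Real.rpow_nonneg hp.le _), ← Real.rpow_mul hp.le,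
    mul_div_assoc', mul_comm p, mul_div_assoc, mul_comm (Z ^ θ)]
  congr 1
  nth_rewrite 1 [← Real.rpow_one p]
  rw [← Real.rpow_sub hp]
  congr 1
  field_simp
  ring

/-- The code for the mixture of the tilted and the uniform distribution. -/
theorem exists_lengthFunction (p : stdSimplex ℝ ι) (θ : ℝ) :
    ∃ L : ι → ℕ, IsLengthFunction L ∧ ∀ x, 0 < p.1 x →
      L x * Real.log 2 ≤ -Real.log ((tilted p θ).1 x) + 2 * Real.log 2 := by
  obtain ⟨x₀, _⟩ := exists_pos p
  have hc : 0 < (Fintype.card ι : ℝ) := Nat.cast_pos.2 (Fintype.card_pos_iff.2 ⟨x₀⟩)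
  have h2 : 0 < Real.log 2 := Real.log_pos one_lt_two
  -- The uniform half keeps `q` positive where the tilted law vanishes, so Kraft's inequality covers
  -- all words. Halving costs one bit and rounding up another, whence `2 * Real.log 2`.
  set q : ι → ℝ := fun x => ((tilted p θ).1 x + (Fintype.card ι : ℝ)⁻¹) / 2 with hq
  have hq0 : ∀ x, 0 < q x := fun x =>
    half_pos (add_pos_of_nonneg_of_pos ((tilted p θ).2.1 x) (inv_pos.2 hc))
  have hsum : ∑ x, q x = 1 := by
    rw [hq, ← Finset.sum_div, Finset.sum_add_distrib, (tilted p θ).2.2, Finset.sum_const,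
      Finset.card_univ, nsmul_eq_mul, mul_inv_cancel₀ hc.ne']
    norm_num
  have hq1 : ∀ x, q x ≤ 1 := fun x => by
    rw [← hsum]
    exact Finset.single_le_sum (fun y _ => (hq0 y).le) (Finset.mem_univ x)
  refine ⟨fun x => ⌈-Real.log (q x) / Real.log 2⌉₊, ?_, fun x hx => ?_⟩
  · rw [IsLengthFunction, ← hsum]
    refine Finset.sum_le_sum fun x _ => ?_
    have h3 := Nat.le_ceil (-Real.log (q x) / Real.log 2)
    rw [div_le_iff₀ h2] at h3
    rw [← Real.log_le_log_iff (by positivity) (hq0 x), Real.log_inv, Real.log_pow]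
    linarith
  · have h0 : 0 ≤ -Real.log (q x) / Real.log 2 :=
      div_nonneg (neg_nonneg.2 (Real.log_nonpos (hq0 x).le (hq1 x))) h2.le
    have h3 := (Nat.ceil_lt_add_one h0).le
    have h4 := mul_le_mul_of_nonneg_right h3 h2.le
    rw [add_mul, div_mul_cancel₀ _ h2.ne'] at h4
    have ht : 0 < (tilted p θ).1 x := tilted_pos hx
    have h5 : Real.log ((tilted p θ).1 x / 2) ≤ Real.log (q x) :=
      Real.log_le_log (by positivity)
        (div_le_div_of_nonneg_right (le_add_of_nonneg_right (inv_pos.2 hc).le) zero_le_two)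
    rw [Real.log_div ht.ne' two_ne_zero] at h5
    linarith

theorem compressionCost_pos {n : ℕ} (p : stdSimplex ℝ (Fin n → X)) (R ρ : ℝ)
    (L : (Fin n → X) → ℕ) : 0 < compressionCost p R ρ L := by
  obtain ⟨x, hx⟩ := exists_pos p
  exact Finset.sum_pos' (fun y _ => mul_nonneg (p.2.1 y) (Real.exp_pos _).le)
    ⟨x, Finset.mem_univ x, mul_pos hx (Real.exp_pos _)⟩

theorem exists_compressionCost_le {n : ℕ} (p : stdSimplex ℝ (Fin n → X)) (R : ℝ) {ρ θ : ℝ}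
    (hθ : θ ∈ Set.Icc 0 ρ) :
    ∃ L, IsLengthFunction L ∧ compressionCost p R ρ L
      ≤ Real.exp (θ * (2 * Real.log 2)) * Real.exp (n * ((ρ - θ) * R))
        * tiltSum p θ ^ (1 + θ) := by
  obtain ⟨L, hL, hLp⟩ := exists_lengthFunction p θ
  refine ⟨L, hL, ?_⟩
  have hZ := tiltSum_pos p θ
  have h1 : tiltSum p θ ^ (1 + θ) = ∑ x, p.1 x ^ (1 + θ)⁻¹ * tiltSum p θ ^ θ := by
    rw [← Finset.sum_mul, Real.rpow_add hZ, Real.rpow_one, tiltSum]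
  rw [h1, Finset.mul_sum, compressionCost]
  refine Finset.sum_le_sum fun x _ => ?_
  rcases (p.2.1 x).eq_or_lt' with h0 | h0
  · rw [h0, zero_mul]
    positivity
  · rw [← mul_rpow_tilt h0 hθ.1 hZ, mul_left_comm]
    refine mul_le_mul_of_nonneg_left ?_ h0.le
    have ht : 0 < (tilted p θ).1 x := tilted_pos h0
    have h2 : tiltSum p θ / p.1 x ^ (1 + θ)⁻¹ = ((tilted p θ).1 x)⁻¹ := by
      rw [tilted_apply, inv_div]
    rw [h2, Real.rpow_def_of_pos (inv_pos.2 ht), Real.log_inv, ← Real.exp_add, ← Real.exp_add]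
    refine Real.exp_le_exp.2 ?_
    -- Split `ρ = θ + (ρ - θ)`, bounding the minimum by the length in the first share and by `n R`
    -- in the second.
    have h3 := mul_le_mul_of_nonneg_left (min_le_left (L x * Real.log 2) (n * R)) hθ.1
    have h4 := mul_le_mul_of_nonneg_left (min_le_right (L x * Real.log 2) (n * R))
      (sub_nonneg.2 hθ.2)
    have h5 := mul_le_mul_of_nonneg_left (hLp x h0) hθ.1
    linarith

theorem eventually_compressionExponentAt_le (P : stdSimplex ℝ X) (R : ℝ) {ρ θ ε : ℝ}
    (hθ : θ ∈ Set.Icc 0 ρ) (hε : 0 < ε) :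
    ∀ᶠ n in atTop, compressionExponentAt (iidSource P) R ρ n
      ≤ (((ρ - θ) * R + (1 + θ) * Real.log (tiltSum P θ) + ε : ℝ) : EReal) := by
  filter_upwards [eventually_rate_le (Real.exp_pos (θ * (2 * Real.log 2)))
    ((ρ - θ) * R + (1 + θ) * Real.log (tiltSum P θ)) hε] with n hn
  obtain ⟨L, hL, hcost⟩ := exists_compressionCost_le (iidSource P n) R hθ
  refine iInf₂_le_of_le L hL (EReal.coe_le_coe_iff.2 (hn _ (compressionCost_pos _ _ _ _) ?_))
  rwa [tiltSum_iidSource_rpow, mul_assoc, ← Real.exp_add, ← mul_add] at hcost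

/-- A typical word with a short codeword has probability at most `exp (-n η / 2) * 2 ^ (-L x)`, and
Kraft's inequality sums these. -/
theorem sum_shortCodewords_le {n : ℕ} (hn : 0 < n) (Q : stdSimplex ℝ X) {L : (Fin n → X) → ℕ}
    (hL : IsLengthFunction L) {m η : ℝ} (hm : m ≤ entropy Q) :
    prob (iidSource Q n) {x | L x * Real.log 2 < n * (m - η)} ≤ untypicalBound Q η n := by
  set A : Set (Fin n → X) := {x | L x * Real.log 2 < n * (m - η)}
  set C : Set (Fin n → X) := {x | selfInfoRate (iidSource Q) n x < entropy Q - η / 2}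
  have hE : 0 < Real.exp (-(n * (η / 2))) := Real.exp_pos _
  have key : ∀ x, A.indicator (iidSource Q n).1 x ≤ C.indicator (iidSource Q n).1 x
      + Real.exp (-(n * (η / 2))) * ((2 : ℝ) ^ L x)⁻¹ := by
    intro x
    have hQ := (iidSource Q n).2.1 x
    by_cases hA : x ∈ A
    · rw [Set.indicator_of_mem hA]
      by_cases hC : x ∈ C
      · rw [Set.indicator_of_mem hC]
        exact le_add_of_nonneg_right (by positivity)
      · rw [Set.indicator_of_notMem hC, zero_add]
        refine (le_exp_of_le_selfInfoRate hn (not_lt.1 hC)).trans ?_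
        rw [← Real.exp_log (by positivity : 0 < ((2 : ℝ) ^ L x)⁻¹), ← Real.exp_add,
          Real.log_inv, Real.log_pow]
        refine Real.exp_le_exp.2 ?_
        have hA' : L x * Real.log 2 < n * (m - η) := hA
        have h1 : (n : ℝ) * m ≤ n * entropy Q := by gcongr
        linarith
    · rw [Set.indicator_of_notMem hA]
      exact add_nonneg (Set.indicator_nonneg (fun y _ => (iidSource Q n).2.1 y) x) (by positivity)
  refine (Finset.sum_le_sum fun x _ => key x).trans ?_
  rw [Finset.sum_add_distrib, ← Finset.mul_sum, untypicalBound, prob]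
  have := mul_le_mul_of_nonneg_left hL hE.le
  linarith

theorem eventually_le_compressionExponentAt {P Q : stdSimplex ℝ X} (h : AbsCont Q P) (R : ℝ)
    {ρ ε : ℝ} (hρ : 0 < ρ) (hε : 0 < ε) :
    ∀ᶠ n in atTop, ((ρ * min (entropy Q) R + entropy Q + meanLog Q P - ε : ℝ) : EReal)
      ≤ compressionExponentAt (iidSource P) R ρ n := by
  classical
  obtain ⟨η, hη, hev⟩ := eventually_le_rate_of_moment h R hρ hε
  filter_upwards [hev, eventually_gt_atTop 0] with n hmom hn
  refine le_iInf₂ fun L hL => EReal.coe_le_coe_iff.2 ?_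
  set A : Set (Fin n → X) := {x | L x * Real.log 2 < n * (min (entropy Q) R - η)}
  refine hmom _ (A.indicator fun _ => 1) (fun x => (Real.exp_pos _).le)
    (Set.indicator_nonneg fun _ _ => zero_le_one) (fun x => ?_) ?_
  · by_cases hx : x ∈ A
    · rw [Set.indicator_of_mem hx, sub_self, mul_zero]
      positivity
    · rw [Set.indicator_of_notMem hx, sub_zero, mul_one]
      refine Real.exp_le_exp.2 (mul_le_mul_of_nonneg_left (le_min (not_lt.1 hx) ?_) hρ.le)
      have := min_le_right (entropy Q) R
      gcongr
      linarith
  · refine le_trans (le_of_eq ?_) (sum_shortCodewords_le hn Q hL (min_le_left _ R))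
    rw [prob]
    refine Finset.sum_congr rfl fun x _ => ?_
    by_cases hx : x ∈ A
    · rw [Set.indicator_of_mem hx, Set.indicator_of_mem hx, mul_one]
    · rw [Set.indicator_of_notMem hx, Set.indicator_of_notMem hx, mul_zero]

/-! ### The guessing exponent -/

theorem exists_equiv_antitone {N : ℕ} (hN : Fintype.card ι = N) (v : ι → ℝ) :
    ∃ e : ι ≃ Fin N, ∀ x x', v x' < v x → e x < e x' := by
  let e₀ := Fintype.equivFinOfCardEq hN
  let f : Fin N → ℝ := fun i => -v (e₀.symm i)
  refine ⟨e₀.trans (Tuple.sort f).symm, fun x x' h => ?_⟩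
  by_contra! hle
  have h1 := Tuple.monotone_sort f hle
  simp only [Function.comp_apply, Equiv.trans_apply, Equiv.apply_symm_apply, f,
    Equiv.symm_apply_apply] at h1
  linarith

theorem exists_isOptimalGuessing {n k : ℕ} (p : stdSimplex ℝ (Fin n → X))
    (f : Encryption X n k) : ∃ G : GuessingStrategy X n, IsOptimalGuessing p f G := by
  classical
  choose G hG using fun y => exists_equiv_antitone (N := Fintype.card X ^ n)
    (by rw [Fintype.card_fun, Fintype.card_fin]) fun x => f.posterior p x y
  exact ⟨G, fun y x x' h => hG y x x' h⟩

/-- The probability of the cryptogram `y` given the message `x`. -/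
def Encryption.channel {A : Type*} {n k : ℕ} (f : Encryption A n k) (x : Fin n → A)
    (y : List Bool) : ℝ :=
  ∑ u : Fin k → Bool, if f.enc x u = y then ((2 : ℝ) ^ k)⁻¹ else 0

theorem Encryption.channel_nonneg {A : Type*} {n k : ℕ} (f : Encryption A n k) (x : Fin n → A)
    (y : List Bool) : 0 ≤ f.channel x y :=
  Finset.sum_nonneg fun u _ => by split_ifs <;> positivity

theorem Encryption.joint_eq {n k : ℕ} (f : Encryption X n k) (p : stdSimplex ℝ (Fin n → X))
    (x : Fin n → X) (y : List Bool) : f.joint p x y = p.1 x * f.channel x y := by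
  rw [Encryption.joint, Encryption.channel, Finset.mul_sum]
  refine Finset.sum_congr rfl fun u _ => ?_
  split_ifs <;> simp

theorem Encryption.joint_nonneg {n k : ℕ} (f : Encryption X n k)
    (p : stdSimplex ℝ (Fin n → X)) (x : Fin n → X) (y : List Bool) : 0 ≤ f.joint p x y := by
  rw [f.joint_eq]
  exact mul_nonneg (p.2.1 x) (f.channel_nonneg x y)

/-- The cryptograms that occur. -/
def Encryption.cryptograms {n k : ℕ} (f : Encryption X n k) : Finset (List Bool) := by
  classical
  exact Finset.univ.image fun xu : (Fin n → X) × (Fin k → Bool) => f.enc xu.1 xu.2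

theorem Encryption.enc_mem {n k : ℕ} (f : Encryption X n k) (x : Fin n → X)
    (u : Fin k → Bool) : f.enc x u ∈ f.cryptograms := by
  classical
  rw [Encryption.cryptograms, Finset.mem_image]
  exact ⟨(x, u), Finset.mem_univ _, rfl⟩

theorem Encryption.sum_channel_mul {n k : ℕ} (f : Encryption X n k) (x : Fin n → X)
    (g : List Bool → ℝ) :
    ∑ y ∈ f.cryptograms, f.channel x y * g y
      = ∑ u : Fin k → Bool, ((2 : ℝ) ^ k)⁻¹ * g (f.enc x u) := by
  simp_rw [Encryption.channel, Finset.sum_mul]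
  rw [Finset.sum_comm]
  refine Finset.sum_congr rfl fun u _ => ?_
  rw [Finset.sum_eq_single (f.enc x u)]
  · rw [if_pos rfl]
  · intro y _ hy
    rw [if_neg hy.symm, zero_mul]
  · exact fun h => absurd (f.enc_mem x u) h

theorem Encryption.sum_channel {n k : ℕ} (f : Encryption X n k) (x : Fin n → X) :
    ∑ y ∈ f.cryptograms, f.channel x y = 1 := by
  have h := f.sum_channel_mul x fun _ => 1
  simp only [mul_one] at h
  rw [h, Finset.sum_const, Finset.card_univ, Fintype.card_fun, Fintype.card_fin, Fintype.card_bool,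
    nsmul_eq_mul]
  push_cast
  exact mul_inv_cancel₀ (by positivity)

theorem guessingMoment_eq {n k : ℕ} (p : stdSimplex ℝ (Fin n → X)) (f : Encryption X n k)
    (G : GuessingStrategy X n) (ρ : ℝ) :
    guessingMoment p f G ρ
      = ∑ y ∈ f.cryptograms, ∑ x, f.joint p x y * (((G y x : ℕ) : ℝ) + 1) ^ ρ := by
  rw [Finset.sum_comm, guessingMoment]
  refine Finset.sum_congr rfl fun x _ => ?_
  have h := f.sum_channel_mul x fun y => p.1 x * (((G y x : ℕ) : ℝ) + 1) ^ ρ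
  calc _ = ∑ u : Fin k → Bool,
        ((2 : ℝ) ^ k)⁻¹ * (p.1 x * (((G (f.enc x u) x : ℕ) : ℝ) + 1) ^ ρ) :=
        Finset.sum_congr rfl fun u _ => by ring
    _ = _ := by
        rw [← h]
        refine Finset.sum_congr rfl fun y _ => ?_
        rw [f.joint_eq]
        ring

/-- The messages guessed no later than `x` are at least as likely as `x`. -/
theorem joint_le_of_le {n k : ℕ} {p : stdSimplex ℝ (Fin n → X)} {f : Encryption X n k}
    {G : GuessingStrategy X n} (hG : IsOptimalGuessing p f G) {y : List Bool} {x x' : Fin n → X}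
    (hx : 0 < f.joint p x y) (hle : G y x' ≤ G y x) : f.joint p x y ≤ f.joint p x' y := by
  by_contra! hlt
  have hS : 0 < ∑ x', f.joint p x' y :=
    Finset.sum_pos' (fun z _ => f.joint_nonneg p z y) ⟨x, Finset.mem_univ x, hx⟩
  exact absurd (hG y x x' (div_lt_div_of_pos_right hlt hS)) (not_lt.2 hle)

theorem guess_eq_card {n : ℕ} (G : GuessingStrategy X n) (y : List Bool) (x : Fin n → X) :
    ((G y x : ℕ) : ℝ) + 1 = (Finset.univ.filter fun x' => G y x' ≤ G y x).card := by
  have h : (Finset.univ.filter fun x' => G y x' ≤ G y x)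
      = (Finset.Iic (G y x)).map (G y).symm.toEmbedding := by
    ext z
    simp [Finset.mem_map_equiv]
  rw [h, Finset.card_map, Fin.card_Iic]
  push_cast
  rfl

/-- Every message guessed no later than `x` is also compatible with `y`, hence owns a key leading to
`y`; invertibility makes these keys distinct. -/
theorem guess_le_two_pow {n k : ℕ} {p : stdSimplex ℝ (Fin n → X)} {f : Encryption X n k}
    {G : GuessingStrategy X n} (hG : IsOptimalGuessing p f G) {y : List Bool} {x : Fin n → X}
    (hx : 0 < f.joint p x y) : ((G y x : ℕ) : ℝ) + 1 ≤ 2 ^ k := by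
  classical
  rw [guess_eq_card]
  have hu : ∀ x' ∈ Finset.univ.filter (fun x' => G y x' ≤ G y x), ∃ u, f.enc x' u = y := by
    intro x' hx'
    have h := hx.trans_le (joint_le_of_le hG hx (Finset.mem_filter.1 hx').2)
    rw [Encryption.joint] at h
    obtain ⟨u, -, hu⟩ := Finset.exists_ne_zero_of_sum_ne_zero h.ne'
    exact ⟨u, by_contra fun hne => hu (if_neg hne)⟩
  choose! u hu using hu
  have h := Finset.card_le_card_of_injOn (t := Finset.univ) u (fun _ _ => Finset.mem_univ _)
    fun a ha b hb hab => f.injective (u a) (by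
      change f.enc a (u a) = f.enc b (u a)
      rw [hu a ha, hab, hu b hb])
  rw [Finset.card_univ, Fintype.card_fun, Fintype.card_fin, Fintype.card_bool] at h
  exact_mod_cast h

/-- Each message guessed no later than `x` contributes a ratio of at least `1` to the right side. -/
theorem guess_le_sum {n k : ℕ} {p : stdSimplex ℝ (Fin n → X)} {f : Encryption X n k}
    {G : GuessingStrategy X n} (hG : IsOptimalGuessing p f G) {y : List Bool} {x : Fin n → X}
    (hx : 0 < f.joint p x y) {a : ℝ} (ha : 0 ≤ a) :
    ((G y x : ℕ) : ℝ) + 1 ≤ (∑ x', f.joint p x' y ^ a) / f.joint p x y ^ a := by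
  rw [guess_eq_card, le_div_iff₀ (Real.rpow_pos_of_pos hx a), ← nsmul_eq_mul, ← Finset.sum_const]
  refine le_trans (Finset.sum_le_sum fun x' hx' => ?_) (Finset.sum_le_sum_of_subset_of_nonneg
    (Finset.filter_subset _ _) fun z _ _ => Real.rpow_nonneg (f.joint_nonneg p z y) a)
  exact Real.rpow_le_rpow hx.le (joint_le_of_le hG hx (Finset.mem_filter.1 hx').2) ha

/-- Conditioning does not increase the sum that governs guessing moments. -/
theorem sum_rpow_joint_le {n k : ℕ} (p : stdSimplex ℝ (Fin n → X)) (f : Encryption X n k) {θ : ℝ}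
    (hθ : 0 ≤ θ) :
    ∑ y ∈ f.cryptograms, (∑ x, f.joint p x y ^ (1 + θ)⁻¹) ^ (1 + θ)
      ≤ tiltSum p θ ^ (1 + θ) := by
  have hZ := tiltSum_pos p θ
  have h1 : 0 < 1 + θ := by positivity
  -- Jensen's inequality for `t ↦ t ^ (1 + θ)` with the tilted law as weights. Summing over `y`
  -- afterwards only uses that the channel has total mass one.
  have key : ∀ y, (∑ x, f.joint p x y ^ (1 + θ)⁻¹) ^ (1 + θ)
      ≤ tiltSum p θ ^ (1 + θ) * ∑ x, (tilted p θ).1 x * f.channel x y := by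
    intro y
    have hJ : ∀ x, f.joint p x y ^ (1 + θ)⁻¹
        = tiltSum p θ * ((tilted p θ).1 x * f.channel x y ^ (1 + θ)⁻¹) := by
      intro x
      rw [f.joint_eq, Real.mul_rpow (p.2.1 x) (f.channel_nonneg x y), tilted_apply]
      field_simp
    have hc : ∀ x, 0 ≤ f.channel x y ^ (1 + θ)⁻¹ := fun x =>
      Real.rpow_nonneg (f.channel_nonneg x y) _
    rw [Finset.sum_congr rfl fun x _ => hJ x, ← Finset.mul_sum, Real.mul_rpow hZ.le
      (Finset.sum_nonneg fun x _ => mul_nonneg ((tilted p θ).2.1 x) (hc x))]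
    refine mul_le_mul_of_nonneg_left ?_ (Real.rpow_nonneg hZ.le _)
    refine (Real.rpow_arith_mean_le_arith_mean_rpow Finset.univ (tilted p θ).1 _
      (fun x _ => (tilted p θ).2.1 x) (tilted p θ).2.2 (fun x _ => hc x) (by linarith)).trans ?_
    refine le_of_eq (Finset.sum_congr rfl fun x _ => ?_)
    rw [Real.rpow_inv_rpow (f.channel_nonneg x y) h1.ne']
  refine (Finset.sum_le_sum fun y _ => key y).trans (le_of_eq ?_)
  rw [← Finset.mul_sum, Finset.sum_comm]
  simp_rw [← Finset.mul_sum, f.sum_channel, mul_one]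
  rw [(tilted p θ).2.2, mul_one]

theorem guessingMoment_le {n k : ℕ} {p : stdSimplex ℝ (Fin n → X)} {f : Encryption X n k}
    {G : GuessingStrategy X n} (hG : IsOptimalGuessing p f G) {ρ θ : ℝ} (hθ : θ ∈ Set.Icc 0 ρ) :
    guessingMoment p f G ρ ≤ ((2 : ℝ) ^ k) ^ (ρ - θ) * tiltSum p θ ^ (1 + θ) := by
  have h1 : 0 < 1 + θ := by linarith [hθ.1]
  rw [guessingMoment_eq]
  refine le_trans ?_ (mul_le_mul_of_nonneg_left (sum_rpow_joint_le p f hθ.1) (by positivity))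
  rw [Finset.mul_sum]
  refine Finset.sum_le_sum fun y _ => ?_
  set S := ∑ x, f.joint p x y ^ (1 + θ)⁻¹ with hS
  have hS0 : 0 ≤ S := Finset.sum_nonneg fun x _ => Real.rpow_nonneg (f.joint_nonneg p x y) _
  have hS1 : S ^ (1 + θ) = ∑ x, f.joint p x y ^ (1 + θ)⁻¹ * S ^ θ := by
    rw [← Finset.sum_mul, ← hS, Real.rpow_add' hS0 h1.ne', Real.rpow_one]
  rw [hS1, Finset.mul_sum]
  refine Finset.sum_le_sum fun x _ => ?_
  rcases (f.joint_nonneg p x y).eq_or_lt' with h0 | h0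
  · rw [h0, zero_mul]
    positivity
  · have hS' : 0 < S := (Real.rpow_pos_of_pos h0 _).trans_le
      (Finset.single_le_sum (f := fun x => f.joint p x y ^ (1 + θ)⁻¹)
        (fun z _ => Real.rpow_nonneg (f.joint_nonneg p z y) _) (Finset.mem_univ x))
    rw [← mul_rpow_tilt h0 hθ.1 hS', mul_left_comm]
    refine mul_le_mul_of_nonneg_left ?_ h0.le
    have hg : 0 < ((G y x : ℕ) : ℝ) + 1 := by positivity
    have h2 := Real.rpow_le_rpow hg.le (guess_le_two_pow hG h0) (sub_nonneg.2 hθ.2)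
    have h3 := Real.rpow_le_rpow hg.le (guess_le_sum hG h0 (inv_nonneg.2 h1.le)) hθ.1
    calc (((G y x : ℕ) : ℝ) + 1) ^ ρ
        = (((G y x : ℕ) : ℝ) + 1) ^ (ρ - θ) * (((G y x : ℕ) : ℝ) + 1) ^ θ := by
          rw [← Real.rpow_add hg, sub_add_cancel]
      _ ≤ _ := mul_le_mul h2 h3 (by positivity) (by positivity)

theorem guessingMoment_pos {n k : ℕ} (p : stdSimplex ℝ (Fin n → X)) (f : Encryption X n k)
    (G : GuessingStrategy X n) (ρ : ℝ) : 0 < guessingMoment p f G ρ := by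
  obtain ⟨x, hx⟩ := exists_pos p
  refine Finset.sum_pos' (fun y _ => Finset.sum_nonneg fun u _ => ?_)
    ⟨x, Finset.mem_univ x, Finset.sum_pos (fun u _ => by positivity) Finset.univ_nonempty⟩
  have := p.2.1 y
  positivity

theorem exp_le_two_pow_keyBits (n : ℕ) (R : ℝ) : Real.exp (n * R) ≤ 2 ^ keyBits n R := by
  have h2 : 0 < Real.log 2 := Real.log_pos one_lt_two
  have h := Nat.le_ceil (n * R / Real.log 2)
  rw [div_le_iff₀ h2] at h
  rw [← Real.le_log_iff_exp_le (by positivity), Real.log_pow]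
  exact h

theorem two_pow_keyBits_le (n : ℕ) {R : ℝ} (hR : 0 ≤ R) :
    (2 : ℝ) ^ keyBits n R ≤ 2 * Real.exp (n * R) := by
  have h2 : 0 < Real.log 2 := Real.log_pos one_lt_two
  have h := (Nat.ceil_lt_add_one (a := n * R / Real.log 2) (by positivity)).le
  have h' := mul_le_mul_of_nonneg_right h h2.le
  rw [add_mul, div_mul_cancel₀ _ h2.ne'] at h'
  rw [← Real.log_le_log_iff (by positivity) (by positivity), Real.log_pow,
    Real.log_mul two_ne_zero (Real.exp_pos _).ne', Real.log_exp]
  rw [keyBits]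
  linarith

theorem eventually_guessingExponentAt_le (P : stdSimplex ℝ X) {R ρ θ ε : ℝ} (hR : 0 ≤ R)
    (hθ : θ ∈ Set.Icc 0 ρ) (hε : 0 < ε) :
    ∀ᶠ n in atTop, guessingExponentAt (iidSource P) R ρ n
      ≤ (((ρ - θ) * R + (1 + θ) * Real.log (tiltSum P θ) + ε : ℝ) : EReal) := by
  filter_upwards [eventually_rate_le (K := (2 : ℝ) ^ (ρ - θ)) (by positivity)
    ((ρ - θ) * R + (1 + θ) * Real.log (tiltSum P θ)) hε] with n hn
  refine iSup_le fun f => iSup₂_le fun G hG => EReal.coe_le_coe_iff.2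
    (hn _ (guessingMoment_pos _ _ _ _) ((guessingMoment_le hG hθ).trans ?_))
  rw [tiltSum_iidSource_rpow, mul_add (n : ℝ), Real.exp_add,
    ← mul_assoc ((2 : ℝ) ^ (ρ - θ))]
  refine mul_le_mul_of_nonneg_right ?_ (Real.exp_pos _).le
  refine (Real.rpow_le_rpow (by positivity) (two_pow_keyBits_le n hR) (sub_nonneg.2 hθ.2)).trans
    (le_of_eq ?_)
  rw [Real.mul_rpow zero_le_two (Real.exp_pos _).le, ← Real.exp_mul]
  congr 2
  ring

/-! ### An encryption that is good against every guessing strategy -/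

/-- Binary strings of different lengths, one for each block and each value of the encrypted
index within the block. -/
def blockString (k : ℕ) (qb : ℕ × (Fin k → Bool)) : List Bool :=
  List.replicate (Encodable.encode qb) true

theorem blockString_injective (k : ℕ) : Function.Injective (blockString k) := by
  intro a b h
  have h' := congrArg List.length h
  simpa [blockString] using h'

/-- The bits of an index within a block. -/
def blockBits (k : ℕ) : Fin (2 ^ k) ≃ (Fin k → Bool) :=
  (Fintype.equivFinOfCardEq (by simp)).symm

/-- Number the messages by `e`, split them into blocks of size `2 ^ k`, leave the block number in
the clear and add the key to the index within the block. -/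
def blockEncryption {A : Type*} {n k N : ℕ} (e : (Fin n → A) ≃ Fin N) : Encryption A n k where
  enc x u := blockString k ((e x : ℕ) / 2 ^ k,
    fun j => xor (blockBits k ⟨(e x : ℕ) % 2 ^ k, Nat.mod_lt _ (by positivity)⟩ j) (u j))
  injective u x x' h := by
    have h1 := blockString_injective k h
    rw [Prod.mk.injEq] at h1
    obtain ⟨hq, hb⟩ := h1
    have h2 : blockBits k ⟨(e x : ℕ) % 2 ^ k, Nat.mod_lt _ (by positivity)⟩
        = blockBits k ⟨(e x' : ℕ) % 2 ^ k, Nat.mod_lt _ (by positivity)⟩ := by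
      funext j
      exact Bool.xor_left_inj.1 (congrFun hb j)
    have h3 := congrArg Fin.val ((blockBits k).injective h2)
    refine e.injective (Fin.ext ?_)
    rw [← Nat.div_add_mod (e x : ℕ) (2 ^ k), ← Nat.div_add_mod (e x' : ℕ) (2 ^ k), hq]
    exact congrArg _ h3

/-- For a fixed message the xor with the key is an involution, so the encrypted index is uniform and
independent of the message. -/
theorem sum_blockEncryption {A : Type*} {n k N : ℕ} (e : (Fin n → A) ≃ Fin N) (x : Fin n → A)
    (g : List Bool → ℝ) :
    ∑ u, g ((blockEncryption (k := k) e).enc x u)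
      = ∑ c, g (blockString k ((e x : ℕ) / 2 ^ k, c)) := by
  let b := blockBits k ⟨(e x : ℕ) % 2 ^ k, Nat.mod_lt _ (by positivity)⟩
  have hb : Function.Involutive fun (u : Fin k → Bool) (j : Fin k) => xor (b j) (u j) := by
    intro u
    funext j
    simp
  exact Equiv.sum_comp (hb.toPerm _) fun c => g (blockString k ((e x : ℕ) / 2 ^ k, c))

/-- In a block other than the first, no element exceeds the average over the previous block. -/
theorem le_prevBlock_avg {N M : ℕ} (hM : 0 < M) {w : ι → ℝ} (hw : ∀ x, 0 ≤ w x) (e : ι ≃ Fin N)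
    (he : ∀ x x', w x' < w x → e x < e x') {x : ι} {j : ℕ} (hj : (e x : ℕ) / M = j + 1) :
    w x ≤ (∑ x' with (e x' : ℕ) / M = j, w x') / M := by
  classical
  have hM' : (0 : ℝ) < M := by positivity
  rw [le_div_iff₀ hM', mul_comm]
  have hlt : ∀ r : Fin M, j * M + r < (e x : ℕ) := by
    intro r
    have h1 := Nat.div_mul_le_self (e x : ℕ) M
    rw [hj, add_mul, one_mul] at h1
    have := r.2
    omega
  let s : Fin M → ι := fun r => e.symm ⟨j * M + r, (hlt r).trans (e x).2⟩
  have hs : ∀ r, (e (s r) : ℕ) = j * M + r := fun r => by simp [s]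
  have hinj : Function.Injective s := fun a b hab => by
    have := congrArg (fun z => (e z : ℕ)) hab
    simp only [hs] at this
    exact Fin.ext (by omega)
  calc (M : ℝ) * w x = ∑ _r : Fin M, w x := by simp
    _ ≤ ∑ r, w (s r) := Finset.sum_le_sum fun r _ => by
        by_contra! hlt'
        have h1 : (e x : ℕ) < e (s r) := he x (s r) hlt'
        rw [hs] at h1
        exact absurd h1 (hlt r).le.not_gt
    _ = ∑ z ∈ Finset.univ.image s, w z := by
        rw [Finset.sum_image fun a _ b _ h => hinj h]
    _ ≤ _ := by
        refine Finset.sum_le_sum_of_subset_of_nonneg (fun z hz => ?_) fun z _ _ => hw z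
        obtain ⟨r, _, rfl⟩ := Finset.mem_image.1 hz
        rw [Finset.mem_filter]
        refine ⟨Finset.mem_univ _, ?_⟩
        rw [hs, mul_comm, Nat.mul_add_div hM, Nat.div_eq_of_lt r.2, add_zero]

/-- A set with few elements in each block has small probability. -/
theorem sum_le_of_card_block_le {N M : ℕ} (hM : 0 < M) (w : stdSimplex ℝ ι) (e : ι ≃ Fin N)
    (he : ∀ x x', w.1 x' < w.1 x → e x < e x') (B : Finset ι) {T τ : ℝ} (hτ : 0 ≤ τ)
    (hB : ∀ j, ((B.filter fun x => (e x : ℕ) / M = j).card : ℝ) ≤ T) :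
    ∑ x ∈ B, w.1 x ≤ prob w {x | τ < w.1 x} + T * τ + T / M := by
  classical
  have hT : 0 ≤ T := le_trans (by positivity) (hB 0)
  let S : ℕ → ℝ := fun j => ∑ x' with (e x' : ℕ) / M = j, w.1 x'
  have hS : ∀ j, 0 ≤ S j := fun j => Finset.sum_nonneg fun x _ => w.2.1 x
  -- A cap on the weight of a word by block: the average of the preceding block, or `τ` in block
  -- `0`, which has none.
  let h : ℕ → ℝ := fun j => j.casesOn τ fun i => S i / M
  have hh : ∀ j, 0 ≤ h j := by
    rintro (_ | j)
    · exact hτ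
    · exact div_nonneg (hS j) (by positivity)
  have key : ∀ x, w.1 x ≤ {x | τ < w.1 x}.indicator w.1 x + h ((e x : ℕ) / M) := by
    intro x
    by_cases hx : x ∈ {x | τ < w.1 x}
    · rw [Set.indicator_of_mem hx]
      exact le_add_of_nonneg_right (hh _)
    · rw [Set.indicator_of_notMem hx, zero_add]
      rcases hq : (e x : ℕ) / M with _ | j
      · exact not_lt.1 hx
      · exact le_prevBlock_avg hM w.2.1 e he hq
  have hmem : ∀ x, (e x : ℕ) / M ∈ Finset.range (N + 1) := fun x => by
    have := Nat.div_le_self (e x : ℕ) M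
    have := (e x).2
    rw [Finset.mem_range]
    omega
  have h1 : ∑ x ∈ B, h ((e x : ℕ) / M) ≤ T * (τ + 1 / M) := by
    rw [← Finset.sum_fiberwise_of_maps_to (t := Finset.range (N + 1)) fun x _ => hmem x]
    have h2 : ∀ j, ∑ x ∈ B with (e x : ℕ) / M = j, h ((e x : ℕ) / M) ≤ T * h j := by
      intro j
      rw [Finset.sum_congr rfl fun x hx => by rw [(Finset.mem_filter.1 hx).2], Finset.sum_const,
        nsmul_eq_mul]
      exact mul_le_mul_of_nonneg_right (hB j) (hh j)
    refine (Finset.sum_le_sum fun j _ => h2 j).trans ?_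
    rw [← Finset.mul_sum, Finset.sum_range_succ']
    refine mul_le_mul_of_nonneg_left ?_ hT
    have h3 : ∑ j ∈ Finset.range N, S j ≤ 1 := by
      have h4 := Finset.sum_fiberwise_of_maps_to (s := Finset.univ) (t := Finset.range (N + 1))
        (fun x _ => hmem x) w.1
      rw [w.2.2] at h4
      rw [← h4, Finset.sum_range_succ]
      exact le_add_of_nonneg_right (hS N)
    have h5 : ∑ j ∈ Finset.range N, h (j + 1) = (∑ j ∈ Finset.range N, S j) / M := by
      rw [Finset.sum_div]
    rw [h5, add_comm]
    exact add_le_add le_rfl (div_le_div_of_nonneg_right h3 (by positivity))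
  have h6 : ∑ x ∈ B, {x | τ < w.1 x}.indicator w.1 x ≤ prob w {x | τ < w.1 x} :=
    Finset.sum_le_sum_of_subset_of_nonneg (Finset.subset_univ B)
      fun x _ _ => Set.indicator_nonneg (fun y _ => w.2.1 y) x
  refine (Finset.sum_le_sum fun x _ => key x).trans ?_
  rw [Finset.sum_add_distrib]
  have h7 : T * (τ + 1 / M) = T * τ + T / M := by ring
  linarith

/-- Few guesses succeed against `blockEncryption`. -/
theorem sum_earlyGuess_le {n k N : ℕ} (w : stdSimplex ℝ (Fin n → X)) (e : (Fin n → X) ≃ Fin N)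
    (he : ∀ x x', w.1 x' < w.1 x → e x < e x') (G : GuessingStrategy X n) {T τ : ℝ}
    (hT : 0 ≤ T) (hτ : 0 ≤ τ) :
    ∑ x, w.1 x * ∑ u : Fin k → Bool, ((2 : ℝ) ^ k)⁻¹ *
        (if ((G ((blockEncryption e).enc x u) x : ℕ) : ℝ) + 1 < T then 1 else 0)
      ≤ prob w {x | τ < w.1 x} + T * τ + T / 2 ^ k := by
  classical
  -- For a fixed encrypted index `c`, each block `j` has a single cryptogram, and its guessing order
  -- names at most `⌊T⌋` messages early.
  let B : (Fin k → Bool) → Finset (Fin n → X) := fun c => Finset.univ.filter fun x =>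
    ((G (blockString k ((e x : ℕ) / 2 ^ k, c)) x : ℕ) : ℝ) + 1 < T
  have hB : ∀ c, ∑ x ∈ B c, w.1 x ≤ prob w {x | τ < w.1 x} + T * τ + T / 2 ^ k := by
    intro c
    have h := sum_le_of_card_block_le (M := 2 ^ k) (T := T) (by positivity) w e he (B c) hτ
      fun j => by
        refine le_trans ?_ (Nat.floor_le hT)
        rw [Nat.cast_le, ← Finset.card_range ⌊T⌋₊]
        refine Finset.card_le_card_of_injOn (fun x => (G (blockString k (j, c)) x : ℕ)) ?_ ?_
        · intro x hx
          rw [Finset.mem_coe, Finset.mem_filter, Finset.mem_filter] at hx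
          obtain ⟨⟨_, hx⟩, hj⟩ := hx
          rw [hj] at hx
          rw [Finset.mem_coe, Finset.mem_range, ← Nat.succ_le_iff]
          refine Nat.le_floor ?_
          push_cast
          exact hx.le
        · intro a _ b _ hab
          exact (G _).injective (Fin.ext hab)
    simpa using h
  calc _ = ∑ x, ∑ c : Fin k → Bool, ((2 : ℝ) ^ k)⁻¹ *
        (if ((G (blockString k ((e x : ℕ) / 2 ^ k, c)) x : ℕ) : ℝ) + 1 < T then w.1 x else 0) := by
        refine Finset.sum_congr rfl fun x _ => ?_
        rw [sum_blockEncryption e x fun y =>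
          ((2 : ℝ) ^ k)⁻¹ * (if ((G y x : ℕ) : ℝ) + 1 < T then 1 else 0), Finset.mul_sum]
        refine Finset.sum_congr rfl fun c _ => ?_
        rw [mul_left_comm, mul_ite, mul_one, mul_zero]
    _ = ∑ c : Fin k → Bool, ((2 : ℝ) ^ k)⁻¹ * ∑ x ∈ B c, w.1 x := by
        rw [Finset.sum_comm]
        refine Finset.sum_congr rfl fun c _ => ?_
        rw [← Finset.mul_sum, Finset.sum_filter]
    _ ≤ ∑ _c : Fin k → Bool,
          ((2 : ℝ) ^ k)⁻¹ * (prob w {x | τ < w.1 x} + T * τ + T / 2 ^ k) :=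
        Finset.sum_le_sum fun c _ => mul_le_mul_of_nonneg_left (hB c) (by positivity)
    _ = _ := by
        rw [Finset.sum_const, Finset.card_univ, Fintype.card_fun, Fintype.card_fin,
          Fintype.card_bool, nsmul_eq_mul]
        push_cast
        exact mul_inv_cancel_left₀ (by positivity) _

theorem eventually_le_guessingExponentAt {P Q : stdSimplex ℝ X} (h : AbsCont Q P) (R : ℝ)
    {ρ ε : ℝ} (hρ : 0 < ρ) (hε : 0 < ε) :
    ∀ᶠ n in atTop, ((ρ * min (entropy Q) R + entropy Q + meanLog Q P - ε : ℝ) : EReal)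
      ≤ guessingExponentAt (iidSource P) R ρ n := by
  classical
  obtain ⟨η, hη, hev⟩ := eventually_le_rate_of_moment h R hρ hε
  filter_upwards [hev, eventually_gt_atTop 0] with n hmom hn
  have hn' : (0 : ℝ) < n := by positivity
  -- The blocks are ordered by `Q ^ n`, although the attacker guesses optimally for `P ^ n`;
  -- `sum_earlyGuess_le` holds for every guessing strategy.
  obtain ⟨e, he⟩ := exists_equiv_antitone (N := Fintype.card X ^ n)
    (by rw [Fintype.card_fun, Fintype.card_fin]) (iidSource Q n).1
  let f : Encryption X n (keyBits n R) := blockEncryption e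
  obtain ⟨G, hG⟩ := exists_isOptimalGuessing (iidSource P n) f
  refine le_iSup_of_le f (le_iSup₂_of_le G hG (EReal.coe_le_coe_iff.2 ?_))
  set m := min (entropy Q) R with hm
  set T := Real.exp (n * (m - η)) with hT
  have hk : (0 : ℝ) < (2 : ℝ) ^ keyBits n R := by positivity
  have hcard : ∑ _u : Fin (keyBits n R) → Bool, ((2 : ℝ) ^ keyBits n R)⁻¹ = 1 := by
    rw [Finset.sum_const, Finset.card_univ, Fintype.card_fun, Fintype.card_fin,
      Fintype.card_bool, nsmul_eq_mul]
    push_cast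
    exact mul_inv_cancel₀ hk.ne'
  have hmom' := hmom
    (fun x => ∑ u, ((2 : ℝ) ^ keyBits n R)⁻¹ * (((G (f.enc x u) x : ℕ) : ℝ) + 1) ^ ρ)
    (fun x => ∑ u, ((2 : ℝ) ^ keyBits n R)⁻¹ *
      (if ((G (f.enc x u) x : ℕ) : ℝ) + 1 < T then 1 else 0))
    (fun x => Finset.sum_nonneg fun u _ => by positivity)
    (fun x => Finset.sum_nonneg fun u _ => mul_nonneg (by positivity) (by split_ifs <;> norm_num))
    (fun x => ?_) ?_
  · refine hmom'.trans (le_of_eq ?_)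
    rw [guessingMoment]
    congr 2
    refine Finset.sum_congr rfl fun x _ => ?_
    rw [Finset.mul_sum]
    exact Finset.sum_congr rfl fun u _ => by ring
  · have hTρ : Real.exp (ρ * (n * (m - η))) = T ^ ρ := by rw [hT, ← Real.exp_mul, mul_comm]
    rw [hTρ]
    nth_rewrite 1 [← hcard]
    rw [← Finset.sum_sub_distrib, Finset.mul_sum]
    refine Finset.sum_le_sum fun u _ => ?_
    split_ifs with hlt
    · rw [mul_one, sub_self, mul_zero]
      positivity
    · rw [mul_zero, sub_zero, mul_comm]
      exact mul_le_mul_of_nonneg_left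
        (Real.rpow_le_rpow (Real.exp_pos _).le (not_lt.1 hlt) hρ.le) (by positivity)
  -- With this `τ`, weights above it are untypical, while `T * τ` and `T / 2 ^ k` are each at most
  -- `exp (-n η / 2)`; hence the factor `2` in `untypicalBound`.
  · refine (sum_earlyGuess_le (iidSource Q n) e he G (T := T)
      (τ := Real.exp (-(n * (entropy Q - η / 2)))) (Real.exp_pos _).le (Real.exp_pos _).le).trans ?_
    have h1 : prob (iidSource Q n)
          {x | Real.exp (-(n * (entropy Q - η / 2))) < (iidSource Q n).1 x}
        ≤ prob (iidSource Q n) {x | selfInfoRate (iidSource Q) n x < entropy Q - η / 2} :=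
      prob_mono _ fun x hx => by
        by_contra hx'
        exact absurd (le_exp_of_le_selfInfoRate hn (not_lt.1 hx')) (not_le.2 hx)
    have h2 : T * Real.exp (-(n * (entropy Q - η / 2))) ≤ Real.exp (-(n * (η / 2))) := by
      rw [hT, ← Real.exp_add]
      refine Real.exp_le_exp.2 ?_
      have := mul_le_mul_of_nonneg_left (min_le_left (entropy Q) R) hn'.le
      linarith
    have h3 : T / 2 ^ keyBits n R ≤ Real.exp (-(n * (η / 2))) := by
      rw [div_le_iff₀ hk]
      refine le_trans ?_ (mul_le_mul_of_nonneg_left (exp_le_two_pow_keyBits n R)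
        (Real.exp_pos _).le)
      rw [hT, ← Real.exp_add]
      refine Real.exp_le_exp.2 ?_
      have h4 := mul_le_mul_of_nonneg_left (min_le_right (entropy Q) R) hn'.le
      have h5 := mul_pos hn' hη
      linarith
    rw [untypicalBound]
    linarith

end GuessingCipher

end

theorem mainTheorem8 {X : Type*} [Fintype X] (P : stdSimplex ℝ X) (R ρ : ℝ)
    (hρ : 0 < ρ) (hR : 0 < R) (hRX : R < Real.log (Fintype.card X)) :
    -- single-letter evaluation of the terms of the general bounds
    GuessingCipher.errorExponentBound (GuessingCipher.iidSource P) R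
        = (⨅ (Q : stdSimplex ℝ X) (_ : R < GuessingCipher.entropy Q),
            GuessingCipher.relEntropy Q P) ∧
    (⨆ (Q : stdSimplex ℝ X) (_ : GuessingCipher.entropy Q ≤ R),
        ((ρ * GuessingCipher.entropy Q : ℝ) : EReal) - GuessingCipher.relEntropy Q P)
      ≤ GuessingCipher.correctDecodingBound (GuessingCipher.iidSource P) R ρ ∧
    (∀ θ ∈ Set.Icc (0 : ℝ) ρ,
      IsGreatest
        (Set.range fun Y : GuessingCipher.Source X =>
          GuessingCipher.upperTiltedRate Y (GuessingCipher.iidSource P) θ)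
        (⨆ Q : stdSimplex ℝ X,
          ((θ * GuessingCipher.entropy Q : ℝ) : EReal) - GuessingCipher.relEntropy Q P)) ∧
    -- the general lower and upper bounds coincide, the minimum in the latter being attained
    GuessingCipher.generalLowerBound (GuessingCipher.iidSource P) R ρ
        = GuessingCipher.singleLetterExponent P R ρ ∧
    GuessingCipher.generalUpperBound (GuessingCipher.iidSource P) R ρ
        = GuessingCipher.singleLetterExponent P R ρ ∧
    (∃ θ ∈ Set.Icc (0 : ℝ) ρ,
      GuessingCipher.upperBoundAt (GuessingCipher.iidSource P) R ρ θ
        = GuessingCipher.generalUpperBound (GuessingCipher.iidSource P) R ρ) ∧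
    -- the compression exponents
    GuessingCipher.upperCompressionExponent (GuessingCipher.iidSource P) R ρ
        = GuessingCipher.singleLetterExponent P R ρ ∧
    GuessingCipher.lowerCompressionExponent (GuessingCipher.iidSource P) R ρ
        = GuessingCipher.singleLetterExponent P R ρ ∧
    -- the guessing exponents, and attainment of the single-letter supremum
    GuessingCipher.upperGuessingExponent (GuessingCipher.iidSource P) R ρ
        = GuessingCipher.singleLetterExponent P R ρ ∧
    GuessingCipher.lowerGuessingExponent (GuessingCipher.iidSource P) R ρ
        = GuessingCipher.singleLetterExponent P R ρ ∧
    (∃ Q : stdSimplex ℝ X,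
      GuessingCipher.singleLetterValue P R ρ Q
        = GuessingCipher.singleLetterExponent P R ρ) := by
  obtain ⟨θ, hθ, hsaddle⟩ := GuessingCipher.exists_saddle P R hρ.le
  have hac := GuessingCipher.absCont_tilted (P := P) hθ.1
  have hval := GuessingCipher.singleLetterValue_of_absCont hac R ρ
  rw [hsaddle] at hval
  have hle := fun Q => GuessingCipher.singleLetterValue_le P Q R hθ
  have hV := GuessingCipher.singleLetterExponent_eq hle hval
  have hU := GuessingCipher.generalUpperBound_eq hθ hval rfl
  have hs := GuessingCipher.tendsto_of_eventually_coe
    -- The lower estimate is taken at the tilted law and the upper one at `θ`; `hsaddle` identifies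
    -- their values, so the limit exists.
    (fun ε hε => hsaddle ▸ GuessingCipher.eventually_le_compressionExponentAt hac R hρ hε)
    (fun ε hε => GuessingCipher.eventually_compressionExponentAt_le P R hθ hε)
  have hg := GuessingCipher.tendsto_of_eventually_coe
    (fun ε hε => hsaddle ▸ GuessingCipher.eventually_le_guessingExponentAt hac R hρ hε)
    (fun ε hε => GuessingCipher.eventually_guessingExponentAt_le P hR.le hθ hε)
  rw [hV]
  exact ⟨GuessingCipher.errorExponentBound_iidSource P R,
    GuessingCipher.le_correctDecodingBound P R ρ,
    fun θ' hθ' => GuessingCipher.isGreatest_upperTiltedRate P hθ'.1,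
    GuessingCipher.generalLowerBound_eq hρ hle hval, hU,
    ⟨θ, hθ, (GuessingCipher.upperBoundAt_iidSource P R ρ hθ.1).trans hU.symm⟩,
    hs.limsup_eq, hs.liminf_eq, hg.limsup_eq, hg.liminf_eq, ⟨_, hval⟩⟩
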